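/- All graphs are finite and simple. For a graph $G$ and a set $D$ of vertices of $G$, let $N[D]$ be the closed neighbourhood of $D$, that is, the set of vertices that belong to $D$ or are adjacent to a vertex in $D$. Let $C_n$ denote the cycle with $n$ vertices, let $\mathcal{C}'$ be the set of cycles of length at least $4$, and let $C_4'$ be the diamond graph, that is, $C_4$ together with one of its two diagonals. The isolation number $\iota(G,\mathcal{C}')$ is the smallest size of a set $D \subseteq V(G)$ such that $N[D]$ intersects the vertex set of every (not necessarily induced) subgraph of $G$ that is a cycle of length at least $4$ (equivalently, $G - N[D]$ contains no cycle of length at least $4$). Let $m \geq 0$ be an integer, let $F$ be a connected graph with $k$ edges, and write $m+1 = q(k+2) + r$ with integers $q \geq 0$ and $0 \leq r \leq k+1$. A graph $G$ is an $(m,F)$-special graph if either $q = 0$ and $G$ is a connected graph with $m$ edges (in which case the remainder graph is $T' = G$), or $q \geq 1$ and $G$ is obtained as follows. Take distinct vertices $v_1, \dots, v_q$ and copies $F_1, \dots, F_q$ of $F$ whose vertex sets are pairwise disjoint and disjoint from $\{v_1, \dots, v_q\}$. For each $i$, choose $w_i \in V(F_i)$, and let $G_i$ (an $F$-constituent of $G$)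 be $F_i$ together with the vertex $v_i$ and the edge $v_iw_i$. Take a tree $T$ with vertex set $\{v_1, \dots, v_q\}$ and a connected graph $T'$ (the remainder graph) with exactly $r$ edges such that $V(T') \cap \bigcup_{i=1}^q V(G_i) = \{v_q\}$. Then $G$ is the union of $T$, $T'$ and $G_1, \dots, G_q$. An $(m,F)$-special graph is pure if $q \geq 1$ and its remainder graph has no edges. **Theorem.** Let $G$ be a connected graph with $m$ edges that is not a copy of $C_4$. Then $$\iota(G, \mathcal{C}') \leq \frac{m+1}{6}.$$ Moreover, the following statements hold: (i) Equality $\iota(G, \mathcal{C}') = \frac{m+1}{6}$ holds if and only if $G$ is a pure $(m, C_4)$-special graph or a copy of $C_4'$ or a copy of $C_5$. (ii) If $G$ is an $(m, C_4)$-special graph, then $\iota(G, \mathcal{C}') = \lfloor (m+1)/6 \rfloor$. -/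

import Mathlib

namespace Isolation

open SimpleGraph

universe u w

/-- A set of (finite) graphs; each member lives on a vertex set `Fin n`. -/
abbrev GraphFamily := Set (Σ n : ℕ, SimpleGraph (Fin n))

/-- `H` is an `𝓕`-graph, that is, a copy of a member of `𝓕`. -/
def IsFamilyGraph (𝓕 : GraphFamily) {V : Type u} (H : SimpleGraph V) : Prop :=
  ∃ F ∈ 𝓕, Nonempty (F.2 ≃g H)

/-- The closed neighbourhood `N[D]` of a set `D` of vertices. -/
def closedNbhd {V : Type u} (G : SimpleGraph V) (D : Set V) : Set V :=
  {x | x ∈ D ∨ ∃ d ∈ D, G.Adj d x}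

/-- `D` is an `𝓕`-isolating set of `G`: its closed neighbourhood `N[D]` intersects the vertex set
of every `𝓕`-graph contained by `G`. -/
def IsIsolatingSet (𝓕 : GraphFamily) {V : Type u} (G : SimpleGraph V) (D : Set V) : Prop :=
  ∀ H : G.Subgraph, IsFamilyGraph 𝓕 H.coe → (closedNbhd G D ∩ H.verts).Nonempty

/-- The `𝓕`-isolation number `ι(G, 𝓕)`: the smallest size of an `𝓕`-isolating set of `G`. -/
noncomputable def isolationNumber (𝓕 : GraphFamily) {V : Type u} (G : SimpleGraph V) : ℕ :=
  sInf {k : ℕ | ∃ D : Finset V, D.card = k ∧ IsIsolatingSet 𝓕 G (D : Set V)}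

/-- The set `𝓒'` of cycles that are not triangles, that is, of cycles of length at least `4`. -/
def nonTriangleCycles : GraphFamily :=
  {F | ∃ n : ℕ, 4 ≤ n ∧ F = ⟨n, cycleGraph n⟩}

/-- The diamond graph: a `4`-cycle together with one of its two diagonals. -/
def diamond : SimpleGraph (Fin 4) :=
  cycleGraph 4 ⊔ edge 0 2

/-- The data exhibiting a graph `G` as an `(m, F)`-special graph, where `F` is a connected graph
with `k` edges. All the graphs the construction glues together are given as subgraphs of `G`. -/
structure SpecialStructure (m : ℕ) {W : Type w} (F : SimpleGraph W) {V : Type u}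
    (G : SimpleGraph V) where
  /-- The graph `F` is connected (in particular it has a vertex). -/
  connected_F : F.Connected
  /-- The number of `F`-constituents: the quotient in the division of `m + 1` by `k + 2`. -/
  q : ℕ
  /-- The remainder in the division of `m + 1` by `k + 2`. -/
  r : ℕ
  division : m + 1 = q * (F.edgeSet.ncard + 2) + r
  r_le : r ≤ F.edgeSet.ncard + 1
  /-- The distinct vertices `v₁, …, v_q` (the `F`-connections), indexed from `0` here. -/
  v : Fin q → V
  v_injective : Function.Injective v
  /-- The copies `F₁, …, F_q` of `F`, disjoint from each other and from `{v₁, …, v_q}`. -/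
  copyF : Fin q → G.Subgraph
  isCopy : ∀ i, Nonempty (F ≃g (copyF i).coe)
  copyF_disjoint : ∀ i j, i ≠ j → Disjoint (copyF i).verts (copyF j).verts
  v_notMem : ∀ i j, v i ∉ (copyF j).verts
  /-- The vertex `wᵢ` of `Fᵢ` to which `vᵢ` is joined. -/
  w : Fin q → V
  w_mem : ∀ i, w i ∈ (copyF i).verts
  adj_v_w : ∀ i, G.Adj (v i) (w i)
  /-- The `F`-constituent `Gᵢ`: the graph `Fᵢ` together with the vertex `vᵢ` and the edge
  `vᵢwᵢ`. -/
  constituent : Fin q → G.Subgraph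
  constituent_eq : ∀ i, constituent i = copyF i ⊔ G.subgraphOfAdj (adj_v_w i)
  /-- The quotient graph `T`: a tree on `{v₁, …, v_q}`, or the null graph if `q = 0`. -/
  T : G.Subgraph
  T_verts : T.verts = Set.range v
  T_tree : 0 < q → T.coe.IsTree
  /-- The remainder graph `T'`. -/
  T' : G.Subgraph
  T'_connected : T'.coe.Connected
  /-- If `q = 0`, then `T'` has `m` edges (and it is all of `G`, by `cover`). -/
  T'_edges_zero : q = 0 → T'.edgeSet.ncard = m
  T'_edges_pos : 0 < q → T'.edgeSet.ncard = r
  /-- If `q ≥ 1`, then the only common vertex of `T'` and the constituents is `v_q`. -/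
  T'_inter : ∀ h : 0 < q,
    T'.verts ∩ (⋃ i, (constituent i).verts) = {v ⟨q - 1, Nat.sub_lt h Nat.one_pos⟩}
  /-- `G` is the union of the quotient graph, the remainder graph and the constituents. -/
  cover : (⊤ : G.Subgraph) = T ⊔ T' ⊔ ⨆ i, constituent i

/-- `G` is an `(m, F)`-special graph. -/
def IsSpecial (m : ℕ) {W : Type w} (F : SimpleGraph W) {V : Type u} (G : SimpleGraph V) : Prop :=
  Nonempty (SpecialStructure m F G)

/-- `G` is a pure `(m, F)`-special graph: it has at least one `F`-constituent, and its remainder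
graph has no edges. -/
def IsPureSpecial (m : ℕ) {W : Type w} (F : SimpleGraph W) {V : Type u} (G : SimpleGraph V) :
    Prop :=
  ∃ S : SpecialStructure m F G, 0 < S.q ∧ S.T'.edgeSet = ∅

end Isolation

/-!
Everything happens inside a fixed graph `G`, with finite vertex sets `S` in place of graphs:
`numEdges G S` counts the edges inside `S`, `ConnectedOn G S` expresses connectedness by cuts, and
`CanIsolate G S k` says that `k` vertices meet, with their closed neighbourhood, all long cycles
(those of length at least `4`) in `S`. The only fact about cycles that is used over and over is
`HasLongCycle.of_union`: if at most one edge joins two disjoint sets, a cycle in their union lies in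
one of them.

`hasSlack_or_isExtremal` shows by induction on `S` that a connected set other than an induced
`4`-cycle (a square) is isolated by `k` vertices with `6 * k ≤ e(S)`, or is extremal: either it has
five edges and minimum degree two, or it induces a pure special graph (`IsConstituentTree`).
Extremal sets satisfy `6 * k = e(S) + 1` and are flexible (`IsTight`): one vertex of an isolating
set of size `k` can be prescribed, and every vertex that is not a connection can be exchanged for
one of the `k` vertices.

If `S` has a bridge with no square on either side, the bounds for the two sides add up, because the
bridge supplies the missing unit. Two extremal sides give a pure special graph if the bridge joins
connections, and flexibility saves a vertex otherwise (`hasSlack_or_isExtremal_of_bridge`). If all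
bridges have a square on one side, the other end of one of them is chosen
(`hasSlack_or_isExtremal_of_pendant_square`).

In a bridgeless set, a vertex `x` of degree at least three is chosen and the components of the rest
are treated by induction (`hasSlack_or_isExtremal_of_bridgeless`). A component `H` is joined to the
neighbours of `x` by at least two edges, so one of these edges is left over after the bound
`6 * k ≤ e(H) + 1` has been paid; squares, for which the bound fails, are first removed when they
have at most three such edges (`hasSlack_of_square`). The edges left over together with those at `x`
number at least six, except in a few configurations around a vertex of degree three, in which the
flexibility of extremal components saves a vertex.

Conversely, the closed neighbourhood of each copy of `C₄` in a special graph lies in its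
constituent, so that `q` vertices are necessary, and the connections suffice
(`SpecialStructure.isolationNumber_eq`).
-/

namespace Isolation

set_option linter.unusedSectionVars false

open Finset

variable {V : Type*} [DecidableEq V] {G : SimpleGraph V} [DecidableRel G.Adj]
variable {A B C S T W H K N M D R Q : Finset V}

/-! ### Counting edges inside and between vertex sets -/

variable (G) in
/-- The number of edges of the subgraph of `G` induced by `S`. -/
def numEdges (S : Finset V) : ℕ := #{e ∈ S.sym2 | e ∈ G.edgeSet}

variable (G) in
/-- The number of adjacent pairs in `A × B`; for disjoint sets this counts the edges between
them. -/
def numCross (A B : Finset V) : ℕ := #(G.interedges A B)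

lemma numCross_comm (A B : Finset V) : numCross G A B = numCross G B A :=
  haveI : Std.Symm G.Adj := ⟨fun _ _ h => h.symm⟩
  Rel.card_interedges_comm A B

lemma numCross_mono (hA : A ⊆ C) (hB : B ⊆ D) : numCross G A B ≤ numCross G C D :=
  card_le_card (SimpleGraph.interedges_mono G hA hB)

lemma numCross_union_right (h : Disjoint B C) :
    numCross G A (B ∪ C) = numCross G A B + numCross G A C := by
  unfold numCross
  rw [← card_union_of_disjoint (SimpleGraph.interedges_disjoint_right G A h)]
  congr 1
  ext ⟨a, b⟩
  simp only [SimpleGraph.mk_mem_interedges_iff, mem_union]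
  tauto

lemma numCross_union_left (h : Disjoint A B) :
    numCross G (A ∪ B) C = numCross G A C + numCross G B C := by
  rw [numCross_comm, numCross_union_right h, numCross_comm C A, numCross_comm C B]

lemma numCross_eq_zero_iff : numCross G A B = 0 ↔ ∀ a ∈ A, ∀ b ∈ B, ¬ G.Adj a b := by
  simp only [numCross, card_eq_zero, eq_empty_iff_forall_notMem, Prod.forall,
    SimpleGraph.mk_mem_interedges_iff, not_and]
  tauto

lemma numCross_pos {a b : V} (ha : a ∈ A) (hb : b ∈ B) (h : G.Adj a b) : 0 < numCross G A B :=
  card_pos.2 ⟨(a, b), by simp [SimpleGraph.mk_mem_interedges_iff, *]⟩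

lemma exists_adj_of_numCross_pos (h : 0 < numCross G A B) : ∃ a ∈ A, ∃ b ∈ B, G.Adj a b := by
  obtain ⟨⟨a, b⟩, hab⟩ := card_pos.1 h
  rw [SimpleGraph.mk_mem_interedges_iff] at hab
  exact ⟨a, hab.1, b, hab.2.1, hab.2.2⟩

lemma eq_of_numCross_le_one (h : numCross G A B ≤ 1) {a b a' b' : V} (ha : a ∈ A) (hb : b ∈ B)
    (hab : G.Adj a b) (ha' : a' ∈ A) (hb' : b' ∈ B) (hab' : G.Adj a' b') : a = a' ∧ b = b' := by
  have := card_le_one.1 h (a, b) (by simp [SimpleGraph.mk_mem_interedges_iff, *]) (a', b')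
    (by simp [SimpleGraph.mk_mem_interedges_iff, *])
  simpa using this

lemma numCross_singleton_left (v : V) (B : Finset V) :
    numCross G {v} B = #{b ∈ B | G.Adj v b} := by
  unfold numCross
  refine (card_bij (fun b _ => (v, b)) ?_ ?_ ?_).symm
  · intro b hb
    simpa [SimpleGraph.mk_mem_interedges_iff] using hb
  · intro b _ b' _ h
    simpa using h
  · rintro ⟨a, b⟩ hab
    simp only [SimpleGraph.mk_mem_interedges_iff, mem_singleton] at hab
    exact ⟨b, by simp [hab.2.1, ← hab.1, hab.2.2], by simp [hab.1]⟩

/-- Deleting a set of pairs that contains an adjacent pair lowers the number of adjacent pairs. -/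
lemma numCross_lt {A' B' : Finset V} (hA : A' ⊆ A) (hB : B' ⊆ B) {a b : V} (ha : a ∈ A)
    (hb : b ∈ B) (hab : G.Adj a b) (h : a ∉ A' ∨ b ∉ B') :
    numCross G A' B' < numCross G A B := by
  refine card_lt_card ((ssubset_iff_of_subset (SimpleGraph.interedges_mono G hA hB)).2
    ⟨(a, b), ?_, ?_⟩)
  · simp [SimpleGraph.mk_mem_interedges_iff, *]
  · simp only [SimpleGraph.mk_mem_interedges_iff]
    tauto

lemma numEdges_mono (h : S ⊆ T) : numEdges G S ≤ numEdges G T :=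
  card_le_card (filter_subset_filter _ (sym2_mono h))

lemma numEdges_union (h : Disjoint A B) :
    numEdges G (A ∪ B) = numEdges G A + numEdges G B + numCross G A B := by
  have hd : ∀ x, x ∈ A → x ∈ B → False := fun x h1 h2 => (disjoint_left.1 h) h1 h2
  have hc : numCross G A B = #((G.interedges A B).image fun p => s(p.1, p.2)) := by
    refine (card_image_of_injOn ?_).symm
    rintro ⟨a, b⟩ h1 ⟨a', b'⟩ h2 h3
    simp only [mem_coe, SimpleGraph.mk_mem_interedges_iff] at h1 h2
    simp only [Sym2.eq_iff] at h3
    rcases h3 with ⟨rfl, rfl⟩ | ⟨rfl, rfl⟩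
    · rfl
    · exact (hd _ h1.1 h2.2.1).elim
  rw [hc]
  unfold numEdges
  rw [← card_union_of_disjoint, ← card_union_of_disjoint]
  · congr 1
    ext e
    induction e with | _ x y
    simp only [mem_filter, mk_mem_sym2_iff, mem_union, SimpleGraph.mem_edgeSet, mem_image,
      Prod.exists, SimpleGraph.mk_mem_interedges_iff, Sym2.eq_iff]
    constructor
    · rintro ⟨⟨hx | hx, hy | hy⟩, hxy⟩
      · exact .inl (.inl ⟨⟨hx, hy⟩, hxy⟩)
      · exact .inr ⟨x, y, ⟨hx, hy, hxy⟩, .inl ⟨rfl, rfl⟩⟩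
      · exact .inr ⟨y, x, ⟨hy, hx, hxy.symm⟩, .inr ⟨rfl, rfl⟩⟩
      · exact .inl (.inr ⟨⟨hx, hy⟩, hxy⟩)
    · rintro ((⟨⟨hx, hy⟩, hxy⟩ | ⟨⟨hx, hy⟩, hxy⟩) | ⟨a, b, ⟨ha, hb, hab⟩, ⟨rfl, rfl⟩ | ⟨rfl, rfl⟩⟩)
      · exact ⟨⟨.inl hx, .inl hy⟩, hxy⟩
      · exact ⟨⟨.inr hx, .inr hy⟩, hxy⟩
      · exact ⟨⟨.inl ha, .inr hb⟩, hab⟩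
      · exact ⟨⟨.inr hb, .inl ha⟩, hab.symm⟩
  · rw [disjoint_left]
    intro e h1 h2
    induction e with | _ x y
    simp only [mem_filter, mk_mem_sym2_iff, mem_union, SimpleGraph.mem_edgeSet, mem_image,
      Prod.exists, SimpleGraph.mk_mem_interedges_iff, Sym2.eq_iff] at h1 h2
    obtain ⟨a, b, ⟨ha, hb, hab⟩, ⟨rfl, rfl⟩ | ⟨rfl, rfl⟩⟩ := h2
    · rcases h1 with ⟨⟨h, h'⟩, -⟩ | ⟨⟨h, h'⟩, -⟩
      · exact hd _ h' hb
      · exact hd _ ha h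
    · rcases h1 with ⟨⟨h, h'⟩, -⟩ | ⟨⟨h, h'⟩, -⟩
      · exact hd _ h hb
      · exact hd _ ha h'
  · rw [disjoint_left]
    intro e h1 h2
    induction e with | _ x y
    simp only [mem_filter, mk_mem_sym2_iff] at h1 h2
    exact hd _ h1.1.1 h2.1.1

@[simp] lemma numEdges_singleton (v : V) : numEdges G {v} = 0 := by
  simp [numEdges, card_eq_zero, Finset.filter_eq_empty_iff]

@[simp] lemma numEdges_empty : numEdges G ∅ = 0 := by
  simp [numEdges]

lemma numEdges_insert {v : V} (h : v ∉ S) :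
    numEdges G (insert v S) = numEdges G S + numCross G {v} S := by
  rw [insert_eq, numEdges_union (by simpa using h)]
  simp

lemma numEdges_add_sdiff (h : A ⊆ S) :
    numEdges G S = numEdges G A + numEdges G (S \ A) + numCross G A (S \ A) := by
  conv_lhs => rw [← union_sdiff_of_subset h]
  exact numEdges_union disjoint_sdiff

/-! ### Long cycles -/

variable (G) in
/-- Some cycle of `G` of length at least `4` has all its vertices in `S`. The cycle has length
`n + 4` and is given by the injective sequence of its vertices, indexed cyclically. -/
def HasLongCycle (S : Finset V) : Prop :=
  ∃ n, ∃ c : Fin (n + 4) → V, c.Injective ∧ (∀ i, G.Adj (c i) (c (i + 1))) ∧ ∀ i, c i ∈ S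

lemma HasLongCycle.mono (h : S ⊆ T) (hS : HasLongCycle G S) : HasLongCycle G T := by
  obtain ⟨n, c, hc, ha, hm⟩ := hS
  exact ⟨n, c, hc, ha, fun i => h (hm i)⟩

lemma HasLongCycle.four_le_card (hS : HasLongCycle G S) : 4 ≤ #S := by
  obtain ⟨n, c, hc, -, hm⟩ := hS
  have := card_le_card_of_injOn (s := univ) c (fun i _ => hm i) hc.injOn
  simp at this
  omega

lemma fin_add_two_ne {n : ℕ} (i : Fin (n + 4)) : i + 1 + 1 ≠ i := by
  intro h
  rw [add_assoc, add_eq_left] at h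
  have := congrArg Fin.val h
  have h2 : 2 % (n + 4) = 2 := Nat.mod_eq_of_lt (by omega)
  simp [Fin.val_add, h2] at this

/-- Consecutive vertices of a cycle span pairwise distinct edges. -/
lemma cycle_edges_injective {n : ℕ} {c : Fin (n + 4) → V} (hc : c.Injective) :
    Function.Injective fun i => s(c i, c (i + 1)) := by
  intro i j h
  simp only [Sym2.eq_iff] at h
  rcases h with h | ⟨h1, h2⟩
  · exact hc h.1
  · have := hc h1
    subst this
    exact (fin_add_two_ne _ (hc h2)).elim

lemma length_le_numEdges {n : ℕ} {c : Fin (n + 4) → V} (hc : c.Injective)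
    (ha : ∀ i, G.Adj (c i) (c (i + 1))) (hm : ∀ i, c i ∈ S) : n + 4 ≤ numEdges G S := by
  have := card_le_card_of_injOn (s := univ) (t := {e ∈ S.sym2 | e ∈ G.edgeSet})
    (fun i => s(c i, c (i + 1))) (fun i _ => by simp [hm, ha]) (cycle_edges_injective hc).injOn
  rwa [card_univ, Fintype.card_fin] at this

lemma HasLongCycle.four_le_numEdges (hS : HasLongCycle G S) : 4 ≤ numEdges G S := by
  obtain ⟨n, c, hc, ha, hm⟩ := hS
  have := length_le_numEdges hc ha hm
  omega

/-- A property of the indices of a cycle that passes on to successors holds everywhere or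
nowhere. -/
lemma fin_forall_of_succ {n : ℕ} {p : Fin (n + 4) → Prop} (h : ∀ i, p i → p (i + 1))
    {i : Fin (n + 4)} (hi : p i) (j : Fin (n + 4)) : p j := by
  have key : ∀ k : ℕ, ∀ j : Fin (n + 4), j.val = (i.val + k) % (n + 4) → p j := by
    intro k
    induction k with
    | zero =>
      intro j hj
      rw [add_zero, Nat.mod_eq_of_lt i.isLt] at hj
      rwa [Fin.ext hj]
    | succ k ih =>
      intro j hj
      have := h _ (ih ⟨(i.val + k) % (n + 4), Nat.mod_lt _ (by omega)⟩ rfl)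
      convert this using 1
      apply Fin.ext
      rw [hj, Fin.val_add]
      simp [← add_assoc]
  refine key (j.val + (n + 4 - i.val)) j ?_
  have hi := i.isLt
  have e : i.val + (j.val + (n + 4 - i.val)) = j.val + (n + 4) := by omega
  rw [e, Nat.add_mod_right, Nat.mod_eq_of_lt j.isLt]

/-- A cycle that meets both sides of a cut uses at least two of its edges, so a cut with at most one
edge has each cycle on one side. -/
lemma HasLongCycle.of_union (hS : HasLongCycle G (A ∪ B)) (hAB : Disjoint A B)
    (h : numCross G A B ≤ 1) : HasLongCycle G A ∨ HasLongCycle G B := by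
  obtain ⟨n, c, hc, ha, hm⟩ := hS
  have hd : ∀ x, x ∈ A → x ∈ B → False := fun x h1 h2 => (disjoint_left.1 hAB) h1 h2
  have hm' : ∀ i, c i ∈ A ∨ c i ∈ B := fun i => by simpa using hm i
  by_contra hcon
  push Not at hcon
  have hA : ∃ i, c i ∈ A := by
    by_contra hno
    push Not at hno
    exact hcon.2 ⟨n, c, hc, ha, fun i => (hm' i).resolve_left (hno i)⟩
  have hB : ∃ i, c i ∈ B := by
    by_contra hno
    push Not at hno
    exact hcon.1 ⟨n, c, hc, ha, fun i => (hm' i).resolve_right (hno i)⟩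
  obtain ⟨i₀, hi₀⟩ := hA
  obtain ⟨j₀, hj₀⟩ := hB
  have hi : ∃ i, c i ∈ A ∧ c (i + 1) ∈ B := by
    by_contra hno
    push Not at hno
    exact hd _ (fin_forall_of_succ (p := fun i => c i ∈ A)
      (fun i hi => (hm' (i + 1)).resolve_right (hno i hi)) hi₀ j₀) hj₀
  have hj : ∃ i, c i ∈ B ∧ c (i + 1) ∈ A := by
    by_contra hno
    push Not at hno
    exact hd _ hi₀ (fin_forall_of_succ (p := fun i => c i ∈ B)
      (fun i hi => (hm' (i + 1)).resolve_left (hno i hi)) hj₀ i₀)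
  obtain ⟨i, hi1, hi2⟩ := hi
  obtain ⟨j, hj1, hj2⟩ := hj
  obtain ⟨h1, h2⟩ := eq_of_numCross_le_one h hi1 hi2 (ha i) hj2 hj1 (ha j).symm
  have h3 := hc h1
  have h4 := hc h2
  rw [h3] at h4
  exact fin_add_two_ne _ h4

/-- A vertex with at most one neighbour in `S` lies on no cycle in `S`. -/
lemma HasLongCycle.erase {v : V} (hS : HasLongCycle G S) (h : numCross G {v} S ≤ 1) :
    HasLongCycle G (S.erase v) := by
  have h' : HasLongCycle G ({v} ∪ S.erase v) :=
    hS.mono fun x hx => by by_cases hxv : x = v <;> simp [*]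
  rcases h'.of_union (by simp) ((numCross_mono subset_rfl (erase_subset _ _)).trans h) with h | h
  · have := h.four_le_card
    simp at this
  · exact h

/-! ### Connected vertex sets and components -/

variable (G) in
/-- The subgraph of `G` induced by `S` is connected, expressed by cuts: every proper nonempty
part of `S` is joined by an edge to the rest of `S`. -/
def ConnectedOn (S : Finset V) : Prop :=
  S.Nonempty ∧ ∀ A ⊆ S, A.Nonempty → A ≠ S → 0 < numCross G A (S \ A)

variable (G) in
/-- `H` is the vertex set of a component of the subgraph of `G` induced by `W`. -/
def IsComponent (H W : Finset V) : Prop :=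
  H ⊆ W ∧ ConnectedOn G H ∧ numCross G H (W \ H) = 0

lemma exists_isComponent_mem {v : V} (hv : v ∈ W) : ∃ H, IsComponent G H W ∧ v ∈ H := by
  -- A smallest union of components that contains `v` is a component.
  obtain ⟨H, hH, hmin⟩ := exists_min_image
    {H ∈ W.powerset | v ∈ H ∧ numCross G H (W \ H) = 0} card
    ⟨W, by simp +contextual [hv, numCross_eq_zero_iff]⟩
  simp only [mem_filter, mem_powerset] at hH hmin
  refine ⟨H, ⟨hH.1, ⟨⟨v, hH.2.1⟩, fun A hA hne hAH => ?_⟩, hH.2.2⟩, hH.2.1⟩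
  by_contra hcon
  have h0 : numCross G A (H \ A) = 0 := by omega
  have hlt : #A < #H := card_lt_card (Finset.ssubset_iff_subset_ne.2 ⟨hA, hAH⟩)
  have hlt' : #(H \ A) < #H := by
    have := card_sdiff_add_card_eq_card hA
    have := hne.card_pos
    omega
  have hW := hH.2.2
  rw [numCross_eq_zero_iff] at h0 hW
  by_cases hvA : v ∈ A
  · have := hmin A ⟨hA.trans hH.1, hvA, by
      rw [numCross_eq_zero_iff]
      intro a ha b hb
      by_cases hbH : b ∈ H
      · exact h0 a ha b (by simp_all)
      · exact hW a (hA ha) b (by simp_all)⟩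
    omega
  · have := hmin (H \ A) ⟨sdiff_subset.trans hH.1, by simp [hvA, hH.2.1], by
      rw [numCross_eq_zero_iff]
      intro a ha b hb
      by_cases hbH : b ∈ H
      · exact fun hadj => h0 b (by simp_all) a ha hadj.symm
      · exact hW a (by simp_all) b (by simp_all)⟩
    omega

lemma IsComponent.of_sdiff (hH : IsComponent G H W) (hK : IsComponent G K (W \ H)) :
    IsComponent G K W := by
  obtain ⟨h1, h2, h3⟩ := hH
  obtain ⟨k1, k2, k3⟩ := hK
  refine ⟨k1.trans sdiff_subset, k2, ?_⟩
  rw [numCross_eq_zero_iff] at *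
  intro a ha b hb
  by_cases hbH : b ∈ H
  · exact fun h => h3 b hbH a (k1 ha) h.symm
  · exact k3 a ha b (by simp_all)

lemma sdiff_card_lt (hH : H ⊆ W) (hne : H.Nonempty) : #(W \ H) < #W := by
  have := card_sdiff_add_card_eq_card hH
  have := hne.card_pos
  omega

lemma exists_isComponent_hasLongCycle (hW : HasLongCycle G W) :
    ∃ H, IsComponent G H W ∧ HasLongCycle G H := by
  induction hn : #W using Nat.strong_induction_on generalizing W with
  | _ n ih =>
    subst hn
    have hne : W.Nonempty := card_pos.1 (by have := hW.four_le_card; omega)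
    obtain ⟨v, hv⟩ := hne
    obtain ⟨H, hH, hvH⟩ := exists_isComponent_mem (G := G) hv
    have hu : HasLongCycle G (H ∪ W \ H) := by rwa [union_sdiff_of_subset hH.1]
    rcases hu.of_union disjoint_sdiff (by rw [hH.2.2]; omega) with h | h
    · exact ⟨H, hH, h⟩
    · obtain ⟨K, hK, hlong⟩ := ih _ (sdiff_card_lt hH.1 ⟨v, hvH⟩) h rfl
      exact ⟨K, hH.of_sdiff hK, hlong⟩

/-- If `W` is `S` without the closed neighbourhood of a vertex `x`, then deleting one component of
`W` from the connected set `S` leaves a connected set. -/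
lemma ConnectedOn.sdiff_component (hS : ConnectedOn G S) (hW : W ⊆ S) (hH : IsComponent G H W)
    {x : V} (hx : x ∈ S \ W) (hxn : ∀ y ∈ S \ W, y ≠ x → G.Adj x y) :
    ConnectedOn G (S \ H) := by
  have hHW := hH.1
  have hxH : x ∈ S \ H := by
    simp only [mem_sdiff] at hx ⊢
    exact ⟨hx.1, fun h => hx.2 (hHW h)⟩
  -- A part of `S \ H` that misses the centre is not closed off in `S`.
  have key : ∀ A ⊆ S \ H, A.Nonempty → x ∉ A → 0 < numCross G A ((S \ H) \ A) := by
    intro A hA hne hxA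
    by_contra hcon
    have h0 : numCross G A ((S \ H) \ A) = 0 := by omega
    have hp := hS.2 A (hA.trans sdiff_subset) hne (by rintro rfl; simp_all)
    obtain ⟨a, ha, b, hb, hab⟩ := exists_adj_of_numCross_pos hp
    rw [numCross_eq_zero_iff] at h0
    have h3 := hH.2.2
    rw [numCross_eq_zero_iff] at h3
    have haW : a ∈ W := by
      by_contra haW
      have haS := hA ha
      simp only [mem_sdiff] at haS
      exact h0 a ha x (by simp_all) (hxn a (by simp_all) (by rintro rfl; exact hxA ha)).symm
    have haS := hA ha
    simp only [mem_sdiff] at haS hb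
    by_cases hbH : b ∈ H
    · exact h3 b hbH a (by simp_all) hab.symm
    · exact h0 a ha b (by simp_all) hab
  refine ⟨⟨x, hxH⟩, fun A hA hne hAS => ?_⟩
  by_cases hxA : x ∈ A
  · have h1 : (S \ H) \ ((S \ H) \ A) = A := by rw [Finset.sdiff_sdiff_eq_self hA]
    have := key ((S \ H) \ A) sdiff_subset
      (sdiff_nonempty.2 fun h => hAS (subset_antisymm hA h)) (by simp [hxA])
    rwa [h1, numCross_comm] at this
  · exact key A hA hne hxA

/-- The two sides of a bridge are connected. -/
lemma ConnectedOn.of_cut_one (hS : ConnectedOn G S) (hA : A ⊆ S) (hne : A.Nonempty)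
    (h : numCross G A (S \ A) ≤ 1) : ConnectedOn G A := by
  refine ⟨hne, fun X hX hXne hXA => ?_⟩
  by_contra hcon
  have h0 : numCross G X (A \ X) = 0 := by omega
  rw [numCross_eq_zero_iff] at h0
  have key : ∀ Y ⊆ A, Y.Nonempty → Y ≠ S → (∀ a ∈ Y, ∀ b ∈ A \ Y, ¬ G.Adj a b) →
      ∃ a ∈ Y, ∃ b ∈ S \ A, G.Adj a b := by
    intro Y hY hYne hYS hY0
    obtain ⟨a, ha, b, hb, hab⟩ := exists_adj_of_numCross_pos (hS.2 Y (hY.trans hA) hYne hYS)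
    simp only [mem_sdiff] at hb
    refine ⟨a, ha, b, ?_, hab⟩
    by_contra hbA
    exact hY0 a ha b (by simp_all) hab
  have hAX : (A \ X).Nonempty := sdiff_nonempty.2 fun h => hXA (subset_antisymm hX h)
  obtain ⟨a, ha, b, hb, hab⟩ := key X hX hXne
    (by rintro rfl; exact hXA (subset_antisymm hX hA)) h0
  obtain ⟨a', ha', b', hb', hab'⟩ := key (A \ X) sdiff_subset hAX
    (by
      rintro h
      obtain ⟨z, hz⟩ := hXne
      have : z ∈ A \ X := h ▸ hA (hX hz)
      simp_all)
    (by
      intro a ha b hb hab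
      rw [Finset.sdiff_sdiff_eq_self hX] at hb
      exact h0 b hb a ha hab.symm)
  have := (eq_of_numCross_le_one h (hX ha) hb hab (sdiff_subset ha') hb' hab').1
  subst this
  simp_all

/-! ### Isolation inside a vertex set -/

variable (G) in
/-- The vertices of `T` outside the closed neighbourhood of `D`. -/
def residual (T D : Finset V) : Finset V := {v ∈ T | v ∉ D ∧ ∀ d ∈ D, ¬ G.Adj d v}

variable (G) in
/-- At most `k` vertices, which need not belong to `T`, suffice to meet with their closed
neighbourhood every long cycle in `T`. -/
def CanIsolate (T : Finset V) (k : ℕ) : Prop :=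
  ∃ D : Finset V, #D ≤ k ∧ ¬ HasLongCycle G (residual G T D)

lemma mem_residual {v : V} : v ∈ residual G T D ↔ v ∈ T ∧ v ∉ D ∧ ∀ d ∈ D, ¬ G.Adj d v := by
  simp [residual]

lemma residual_subset : residual G T D ⊆ T := filter_subset _ _

lemma residual_mono (hT : T ⊆ S) (hD : D ⊆ M) : residual G T M ⊆ residual G S D := by
  intro v
  simp only [mem_residual]
  exact fun h => ⟨hT h.1, fun h' => h.2.1 (hD h'), fun d hd => h.2.2 d (hD hd)⟩

lemma residual_union : residual G (A ∪ B) D = residual G A D ∪ residual G B D :=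
  filter_union _ _ _

lemma residual_singleton_subset (v : V) : residual G T {v} ⊆ T.erase v := by
  intro u hu
  simp only [mem_residual, mem_singleton] at hu
  exact mem_erase.2 ⟨hu.2.1, hu.1⟩

/-- Three vertices are too few for a long cycle. -/
lemma not_hasLongCycle_of_subset_erase {v : V} (hS : #S ≤ 4) (hv : v ∈ S) (hT : T ⊆ S.erase v) :
    ¬ HasLongCycle G T := by
  intro hL
  have := (hL.mono hT).four_le_card
  rw [card_erase_of_mem hv] at this
  omega

lemma not_hasLongCycle_residual_union (hAB : Disjoint A B)
    (h : numCross G (residual G A D) (residual G B D) ≤ 1)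
    (hA : ¬ HasLongCycle G (residual G A D)) (hB : ¬ HasLongCycle G (residual G B D)) :
    ¬ HasLongCycle G (residual G (A ∪ B) D) := by
  intro hL
  rw [residual_union] at hL
  rcases hL.of_union (disjoint_of_subset_left residual_subset
    (disjoint_of_subset_right residual_subset hAB)) h with h | h
  exacts [hA h, hB h]

lemma not_hasLongCycle_residual_union_union (hAB : Disjoint A B) (h : numCross G A B ≤ 1)
    {D₁ D₂ : Finset V} (hA : ¬ HasLongCycle G (residual G A D₁))
    (hB : ¬ HasLongCycle G (residual G B D₂)) :
    ¬ HasLongCycle G (residual G (A ∪ B) (D₁ ∪ D₂)) :=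
  not_hasLongCycle_residual_union hAB
    ((numCross_mono residual_subset residual_subset).trans h)
    (fun h' => hA (h'.mono (residual_mono subset_rfl subset_union_left)))
    (fun h' => hB (h'.mono (residual_mono subset_rfl subset_union_right)))

lemma CanIsolate.union {k l : ℕ} (hA : CanIsolate G A k) (hB : CanIsolate G B l)
    (hAB : Disjoint A B) (h : numCross G A B ≤ 1) : CanIsolate G (A ∪ B) (k + l) := by
  obtain ⟨D₁, h1, h1'⟩ := hA
  obtain ⟨D₂, h2, h2'⟩ := hB
  exact ⟨D₁ ∪ D₂, (card_union_le _ _).trans (by omega),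
    not_hasLongCycle_residual_union_union hAB h h1' h2'⟩

lemma canIsolate_of_not_hasLongCycle (h : ¬ HasLongCycle G S) (k : ℕ) : CanIsolate G S k :=
  ⟨∅, by simp, fun h' => h (h'.mono residual_subset)⟩

lemma CanIsolate.mono {k : ℕ} (h : CanIsolate G T k) (hS : S ⊆ T) : CanIsolate G S k := by
  obtain ⟨D, h1, h2⟩ := h
  exact ⟨D, h1, fun h' => h2 (h'.mono (residual_mono hS subset_rfl))⟩

/-- To bound the number of vertices needed for `W \ M` by a count of edges, it suffices to do so
for each component of `W`. If each component saves one edge, then so does `W`, unless it is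
empty. -/
lemma canIsolate_of_components {M W : Finset V}
    (h : ∀ H, IsComponent G H W →
      ∃ k, CanIsolate G (H \ M) k ∧ 6 * k + 1 ≤ numEdges G H + numCross G N H) :
    ∃ k, CanIsolate G (W \ M) k ∧ 6 * k ≤ numEdges G W + numCross G N W ∧
      (W.Nonempty → 6 * k + 1 ≤ numEdges G W + numCross G N W) := by
  induction hn : #W using Nat.strong_induction_on generalizing W with
  | _ n ih =>
    subst hn
    rcases W.eq_empty_or_nonempty with rfl | ⟨v, hv⟩
    · refine ⟨0, canIsolate_of_not_hasLongCycle (fun h => ?_) 0, by simp, by simp⟩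
      have := h.four_le_card
      simp at this
    · obtain ⟨H, hH, hvH⟩ := exists_isComponent_mem (G := G) hv
      obtain ⟨k, hk, hke⟩ := h H hH
      obtain ⟨l, hl, hle, -⟩ := ih _ (sdiff_card_lt hH.1 ⟨v, hvH⟩)
        (fun K hK => h K (hH.of_sdiff hK)) rfl
      have h1 := numEdges_add_sdiff (G := G) hH.1
      have h2 : numCross G N W = numCross G N H + numCross G N (W \ H) := by
        rw [← numCross_union_right disjoint_sdiff, union_sdiff_of_subset hH.1]
      have h3 : CanIsolate G (W \ M) (k + l) := by
        have := hk.union hl (disjoint_of_subset_left sdiff_subset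
          (disjoint_of_subset_right sdiff_subset disjoint_sdiff))
          ((numCross_mono sdiff_subset sdiff_subset).trans (by rw [hH.2.2]; omega))
        rwa [← union_sdiff_distrib, union_sdiff_of_subset hH.1] at this
      exact ⟨k + l, h3, by omega, fun _ => by omega⟩

/-! ### Squares -/

variable (G) in
/-- `S` is the vertex set of an induced `4`-cycle. -/
def IsSquare (S : Finset V) : Prop :=
  ∃ a b c d, S = {a, b, c, d} ∧ a ≠ c ∧ b ≠ d ∧ G.Adj a b ∧ G.Adj b c ∧ G.Adj c d ∧ G.Adj d a ∧
    ¬ G.Adj a c ∧ ¬ G.Adj b d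

lemma numEdges_quadrilateral {a b c d : V} (hac : a ≠ c) (hbd : b ≠ d) (hab : G.Adj a b)
    (hbc : G.Adj b c) (hcd : G.Adj c d) (hda : G.Adj d a) :
    numEdges G {a, b, c, d} =
      4 + (if G.Adj a c then 1 else 0) + (if G.Adj b d then 1 else 0) := by
  have h1 := hab.ne
  have h2 := hbc.ne
  have h3 := hcd.ne
  have h4 := hda.ne'
  rw [numEdges_insert (by simp [*]), numEdges_insert (by simp [*]), numEdges_insert (by simp [*])]
  simp only [numCross_singleton_left, filter_insert, filter_singleton, hab, hbc, hcd, hda.symm,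
    numEdges_singleton, if_true]
  split_ifs <;> simp [*]

lemma IsSquare.numEdges_eq (h : IsSquare G S) : numEdges G S = 4 := by
  obtain ⟨a, b, c, d, rfl, hac, hbd, h1, h2, h3, h4, h5, h6⟩ := h
  rw [numEdges_quadrilateral hac hbd h1 h2 h3 h4]
  simp [h5, h6]

lemma IsSquare.card_eq (h : IsSquare G S) : #S = 4 := by
  obtain ⟨a, b, c, d, rfl, hac, hbd, h1, h2, h3, h4, -, -⟩ := h
  have := h1.ne
  have := h2.ne
  have := h3.ne
  have := h4.ne'
  rw [card_insert_of_notMem (by simp [*]), card_insert_of_notMem (by simp [*]),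
    card_insert_of_notMem (by simp [*]), card_singleton]

lemma IsSquare.canIsolate_one (h : IsSquare G S) : CanIsolate G S 1 := by
  obtain ⟨v, hv⟩ : S.Nonempty := card_pos.1 (by rw [h.card_eq]; omega)
  exact ⟨{v}, by simp, not_hasLongCycle_of_subset_erase h.card_eq.le hv
    (residual_singleton_subset v)⟩

lemma IsSquare.two_le_numCross (h : IsSquare G S) {v : V} (hv : v ∈ S) :
    2 ≤ numCross G {v} S := by
  obtain ⟨a, b, c, d, rfl, hac, hbd, h1, h2, h3, h4, h5, h6⟩ := h
  have key : ∀ x y, x ≠ y → x ∈ ({a, b, c, d} : Finset V) → y ∈ ({a, b, c, d} : Finset V) →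
      G.Adj v x → G.Adj v y → 2 ≤ numCross G {v} {a, b, c, d} := by
    intro x y hxy hx hy hvx hvy
    rw [numCross_singleton_left, ← card_pair hxy]
    refine card_le_card fun z hz => ?_
    simp only [mem_insert, mem_singleton] at hz
    rcases hz with rfl | rfl <;> simp only [mem_filter, *, and_self]
  simp only [mem_insert, mem_singleton] at hv
  rcases hv with rfl | rfl | rfl | rfl
  · exact key b d hbd (by simp) (by simp) h1 h4.symm
  · exact key a c hac (by simp) (by simp) h1.symm h2
  · exact key b d hbd (by simp) (by simp) h2.symm h3
  · exact key a c hac (by simp) (by simp) h4 h3.symm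

lemma IsSquare.exists_not_adj (h : IsSquare G S) {v : V} (hv : v ∈ S) :
    ∃ u ∈ S, u ≠ v ∧ ¬ G.Adj v u := by
  obtain ⟨a, b, c, d, rfl, hac, hbd, -, -, -, -, h5, h6⟩ := h
  simp only [mem_insert, mem_singleton] at hv
  rcases hv with rfl | rfl | rfl | rfl
  · exact ⟨c, by simp, hac.symm, h5⟩
  · exact ⟨d, by simp, hbd.symm, h6⟩
  · exact ⟨a, by simp, hac, fun h => h5 h.symm⟩
  · exact ⟨b, by simp, hbd, fun h => h6 h.symm⟩

/-- Any two vertices of a `4`-cycle lie in the closed neighbourhood of a common vertex of it. -/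
lemma IsSquare.exists_dominating (h : IsSquare G S) {u v : V} (hu : u ∈ S) (hv : v ∈ S) :
    ∃ a ∈ S, (u = a ∨ G.Adj a u) ∧ (v = a ∨ G.Adj a v) := by
  obtain ⟨a, b, c, d, rfl, hac, hbd, h1, h2, h3, h4, h5, h6⟩ := h
  have h1' := h1.symm
  have h2' := h2.symm
  have h3' := h3.symm
  have h4' := h4.symm
  simp only [mem_insert, mem_singleton] at hu hv
  rcases hu with rfl | rfl | rfl | rfl <;> rcases hv with rfl | rfl | rfl | rfl <;>
    simp only [mem_insert, mem_singleton, exists_eq_or_imp, exists_eq_left, *, true_or, or_true,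
      and_self, and_true, true_and]

/-- A connected set with a long cycle and at most four edges is an induced `4`-cycle. -/
lemma ConnectedOn.isSquare (hS : ConnectedOn G S) (hL : HasLongCycle G S)
    (he : numEdges G S ≤ 4) : IsSquare G S := by
  obtain ⟨n, c, hc, ha, hm⟩ := hL
  have hn := length_le_numEdges hc ha hm
  obtain rfl : n = 0 := by omega
  have h01 : G.Adj (c 0) (c 1) := ha 0
  have h12 : G.Adj (c 1) (c 2) := ha 1
  have h23 : G.Adj (c 2) (c 3) := ha 2
  have h30 : G.Adj (c 3) (c 0) := ha 3
  have h02 : c 0 ≠ c 2 := hc.ne (by decide)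
  have h13 : c 1 ≠ c 3 := hc.ne (by decide)
  have hq := numEdges_quadrilateral h02 h13 h01 h12 h23 h30
  have hT : ({c 0, c 1, c 2, c 3} : Finset V) ⊆ S := by
    intro x hx
    simp only [mem_insert, mem_singleton] at hx
    rcases hx with rfl | rfl | rfl | rfl <;> exact hm _
  have hST : ({c 0, c 1, c 2, c 3} : Finset V) = S := by
    by_contra hne
    have := hS.2 _ hT (by simp) hne
    have := numEdges_add_sdiff (G := G) hT
    omega
  rw [hST] at hq
  refine ⟨c 0, c 1, c 2, c 3, hST.symm, h02, h13, h01, h12, h23, h30, fun h => ?_, fun h => ?_⟩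
  · rw [if_pos h] at hq
    omega
  · rw [if_pos h] at hq
    omega

/-! ### The extremal vertex sets -/

variable (G) in
/-- `S` induces a pure special graph and `Q` is the set of the connection vertices of its
constituents. Such a graph arises from single constituents (a square together with a vertex joined
to it by one edge) by repeatedly joining two of them by an edge between connection vertices. -/
inductive IsConstituentTree : Finset V → Finset V → Prop
  | single {K : Finset V} {y : V} (hK : IsSquare G K) (hy : y ∉ K) (hx : numCross G {y} K = 1) :
      IsConstituentTree (insert y K) {y}
  | join {S₁ S₂ Q₁ Q₂ : Finset V} (h₁ : IsConstituentTree S₁ Q₁) (h₂ : IsConstituentTree S₂ Q₂)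
      (hd : Disjoint S₁ S₂) (hS : numCross G S₁ S₂ = 1) (hQ : numCross G Q₁ Q₂ = 1) :
      IsConstituentTree (S₁ ∪ S₂) (Q₁ ∪ Q₂)

variable (G) in
/-- `S` induces a graph with five edges and minimum degree at least two. If it is connected and
has a long cycle, it is a `5`-cycle or a diamond. -/
def IsSmallExtremal (S : Finset V) : Prop :=
  numEdges G S = 5 ∧ ∀ v ∈ S, 2 ≤ numCross G {v} S

variable (G) in
/-- `S` is one of the vertex sets for which the bound is attained. -/
def IsExtremal (S : Finset V) : Prop :=
  IsSmallExtremal G S ∨ ∃ Q, IsConstituentTree G S Q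

variable (G) in
/-- The properties of extremal vertex sets on which the induction rests: `k` vertices are enough,
one of them can be prescribed, and any vertex outside `Q` can be traded for one of them. If there
are vertices in `Q` at all, then `Q` itself can be taken. -/
structure IsTight (S Q : Finset V) (k : ℕ) : Prop where
  subset : Q ⊆ S
  edges : 6 * k = numEdges G S + 1
  exists_mem : ∀ y ∈ S, ∃ D, y ∈ D ∧ #D ≤ k ∧ ¬ HasLongCycle G (residual G S D)
  exists_erase : ∀ z ∈ S, z ∉ Q → ∃ D, #D + 1 ≤ k ∧ ¬ HasLongCycle G (residual G (S.erase z) D)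
  of_nonempty : Q.Nonempty → #Q ≤ k ∧ ¬ HasLongCycle G (residual G S Q)

lemma numEdges_erase_add {v : V} (hv : v ∈ S) :
    numEdges G (S.erase v) + numCross G {v} S = numEdges G S := by
  have h := numEdges_insert (G := G) (notMem_erase v S)
  rw [insert_erase hv] at h
  rw [h]
  congr 1
  rw [numCross_singleton_left, numCross_singleton_left]
  congr 1
  ext x
  simp only [mem_filter, mem_erase]
  exact ⟨fun h => ⟨⟨h.2.ne', h.1⟩, h.2⟩, fun h => ⟨h.1.2, h.2⟩⟩

lemma IsSmallExtremal.isTight (h : IsSmallExtremal G S) : IsTight G S ∅ 1 := by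
  -- Without any one vertex, at most three edges are left, too few for a long cycle.
  have key : ∀ v ∈ S, ¬ HasLongCycle G (S.erase v) := by
    intro v hv hL
    have := hL.four_le_numEdges
    have := numEdges_erase_add (G := G) hv
    have := h.2 v hv
    have := h.1
    omega
  refine ⟨by simp, by rw [h.1], fun y hy => ⟨{y}, by simp, by simp, fun hL => key y hy ?_⟩,
    fun z hz _ => ⟨∅, by simp, fun hL => key z hz (hL.mono residual_subset)⟩, by simp⟩
  exact hL.mono (residual_singleton_subset y)

lemma isTight_single {K : Finset V} {y : V} (hK : IsSquare G K) (hy : y ∉ K)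
    (hx : numCross G {y} K = 1) : IsTight G (insert y K) {y} 1 := by
  have hcard := hK.card_eq
  obtain ⟨w, hw, hyw⟩ : ∃ w ∈ K, G.Adj y w := by
    obtain ⟨y', hy', w, hw, h⟩ := exists_adj_of_numCross_pos
      (by omega : 0 < numCross G {y} K)
    rw [mem_singleton] at hy'
    exact ⟨w, hw, hy' ▸ h⟩
  have hyD : ¬ HasLongCycle G (residual G (insert y K) {y}) := by
    refine not_hasLongCycle_of_subset_erase hcard.le hw fun v hv => ?_
    simp only [mem_residual, mem_insert, mem_singleton, forall_eq] at hv
    rcases hv.1 with rfl | h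
    · exact absurd rfl hv.2.1
    · exact mem_erase.2 ⟨by rintro rfl; exact hv.2.2 hyw, h⟩
  refine ⟨by simp, ?_, fun z hz => ?_, fun z hz hzy => ?_, fun _ => ⟨by simp, hyD⟩⟩
  · rw [numEdges_insert hy, hK.numEdges_eq, hx]
  · rcases eq_or_ne z y with rfl | hzy
    · exact ⟨{z}, by simp, by simp, hyD⟩
    · have hzK : z ∈ K := by simpa [hzy] using hz
      refine ⟨{z}, by simp, by simp, fun hL => ?_⟩
      have h4 := hL.four_le_card
      have h2 := hK.two_le_numCross hzK
      rw [numCross_singleton_left] at h2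
      have : residual G (insert y K) {z} ⊆ insert y (K \ {b ∈ K | G.Adj z b}) := by
        intro v hv
        simp only [mem_residual, mem_insert, mem_singleton, forall_eq] at hv
        simp only [mem_insert, mem_sdiff, mem_filter]
        tauto
      have := card_le_card this
      have := card_insert_le y (K \ {b ∈ K | G.Adj z b})
      have := card_sdiff_add_card_eq_card (filter_subset (fun b => G.Adj z b) K)
      omega
  · have hzy : z ≠ y := by simpa using hzy
    have hzK : z ∈ K := by simpa [hzy] using hz
    refine ⟨∅, by simp, fun hL => ?_⟩
    have hL' : HasLongCycle G ({y} ∪ K.erase z) := by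
      refine hL.mono fun v hv => ?_
      have := residual_subset hv
      simp only [mem_erase, mem_insert] at this
      simp only [mem_union, mem_singleton, mem_erase]
      tauto
    rcases hL'.of_union (by simp [hy]) ((numCross_mono subset_rfl (erase_subset _ _)).trans hx.le)
      with h | h
    · have := h.four_le_card
      simp at this
    · exact not_hasLongCycle_of_subset_erase hcard.le hzK subset_rfl h

lemma isTight_join {S₁ S₂ Q₁ Q₂ : Finset V} {k₁ k₂ : ℕ} (h₁ : IsTight G S₁ Q₁ k₁)
    (h₂ : IsTight G S₂ Q₂ k₂) (hQ₁ : Q₁.Nonempty) (hQ₂ : Q₂.Nonempty) (hd : Disjoint S₁ S₂)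
    (hS : numCross G S₁ S₂ = 1) : IsTight G (S₁ ∪ S₂) (Q₁ ∪ Q₂) (k₁ + k₂) := by
  obtain ⟨c₁, l₁⟩ := h₁.of_nonempty hQ₁
  obtain ⟨c₂, l₂⟩ := h₂.of_nonempty hQ₂
  have e₁ := h₁.edges
  have e₂ := h₂.edges
  refine ⟨union_subset_union h₁.subset h₂.subset, ?_, fun y hy => ?_, fun z hz hzQ => ?_,
    fun _ => ⟨?_, ?_⟩⟩
  · rw [numEdges_union hd]
    omega
  · rcases mem_union.1 hy with hy | hy
    · obtain ⟨D, hyD, hc, hl⟩ := h₁.exists_mem y hy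
      exact ⟨D ∪ Q₂, by simp [hyD], (card_union_le _ _).trans (by omega),
        not_hasLongCycle_residual_union_union hd hS.le hl l₂⟩
    · obtain ⟨D, hyD, hc, hl⟩ := h₂.exists_mem y hy
      exact ⟨Q₁ ∪ D, by simp [hyD], (card_union_le _ _).trans (by omega),
        not_hasLongCycle_residual_union_union hd hS.le l₁ hl⟩
  · simp only [mem_union, not_or] at hzQ
    rcases mem_union.1 hz with hz | hz
    · obtain ⟨D, hc, hl⟩ := h₁.exists_erase z hz hzQ.1
      refine ⟨D ∪ Q₂, by have := card_union_le D Q₂; omega, ?_⟩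
      have hz2 : z ∉ S₂ := disjoint_left.1 hd hz
      rw [erase_union_distrib, erase_eq_of_notMem hz2]
      exact not_hasLongCycle_residual_union_union
        (disjoint_of_subset_left (erase_subset _ _) hd)
        ((numCross_mono (erase_subset _ _) subset_rfl).trans hS.le) hl l₂
    · obtain ⟨D, hc, hl⟩ := h₂.exists_erase z hz hzQ.2
      refine ⟨Q₁ ∪ D, by have := card_union_le Q₁ D; omega, ?_⟩
      have hz2 : z ∉ S₁ := disjoint_right.1 hd hz
      rw [erase_union_distrib, erase_eq_of_notMem hz2]
      exact not_hasLongCycle_residual_union_union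
        (disjoint_of_subset_right (erase_subset _ _) hd)
        ((numCross_mono subset_rfl (erase_subset _ _)).trans hS.le) l₁ hl
  · exact (card_union_le _ _).trans (by omega)
  · exact not_hasLongCycle_residual_union_union hd hS.le l₁ l₂

lemma IsConstituentTree.nonempty {Q : Finset V} (h : IsConstituentTree G S Q) : Q.Nonempty := by
  induction h with
  | single => simp
  | join _ _ _ _ _ ih _ => exact ih.mono subset_union_left

lemma IsConstituentTree.isTight {Q : Finset V} (h : IsConstituentTree G S Q) :
    ∃ k, IsTight G S Q k := by
  induction h with
  | single hK hy hx => exact ⟨1, isTight_single hK hy hx⟩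
  | join h₁ h₂ hd hS _ ih₁ ih₂ =>
    obtain ⟨k₁, hk₁⟩ := ih₁
    obtain ⟨k₂, hk₂⟩ := ih₂
    exact ⟨k₁ + k₂, isTight_join hk₁ hk₂ h₁.nonempty h₂.nonempty hd hS⟩

lemma IsExtremal.isTight (h : IsExtremal G S) :
    ∃ Q k, IsTight G S Q k ∧ (Q.Nonempty → IsConstituentTree G S Q) := by
  rcases h with h | ⟨Q, hQ⟩
  · exact ⟨∅, 1, h.isTight, by simp⟩
  · obtain ⟨k, hk⟩ := hQ.isTight
    exact ⟨Q, k, hk, fun _ => hQ⟩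

/-! ### Reductions along a bridge -/

variable (G) in
/-- The bound holds for `S` with room to spare: `k` vertices with `6 * k < e(S) + 1` suffice. -/
def HasSlack (S : Finset V) : Prop := ∃ k, CanIsolate G S k ∧ 6 * k ≤ numEdges G S

lemma IsTight.canIsolate {Q : Finset V} {k : ℕ} (h : IsTight G S Q k) (hS : S.Nonempty) :
    CanIsolate G S k := by
  obtain ⟨y, hy⟩ := hS
  obtain ⟨D, -, h⟩ := h.exists_mem y hy
  exact ⟨D, h⟩

lemma exists_canIsolate (h : HasSlack G S ∨ IsExtremal G S) (hS : S.Nonempty) :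
    ∃ k, CanIsolate G S k ∧ 6 * k ≤ numEdges G S + 1 := by
  rcases h with ⟨k, h1, h2⟩ | h
  · exact ⟨k, h1, by omega⟩
  · obtain ⟨Q, k, ht, -⟩ := h.isTight
    exact ⟨k, ht.canIsolate hS, ht.edges.le⟩

/-- If the bridge between two tight sets ends in a vertex outside `Q₁`, then the other end can be
prescribed on its side, which saves one vertex on the first side. -/
lemma hasSlack_of_bridge_not_mem {Q₁ Q₂ : Finset V} {k₁ k₂ : ℕ} (hA : IsTight G A Q₁ k₁)
    (hB : IsTight G B Q₂ k₂) (hd : Disjoint A B) (hx : numCross G A B = 1) {a b : V} (ha : a ∈ A)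
    (hb : b ∈ B) (hab : G.Adj a b) (haQ : a ∉ Q₁) : HasSlack G (A ∪ B) := by
  obtain ⟨D₁, hc₁, hl₁⟩ := hA.exists_erase a ha haQ
  obtain ⟨D₂, hbD, hc₂, hl₂⟩ := hB.exists_mem b hb
  have e₁ := hA.edges
  have e₂ := hB.edges
  refine ⟨k₁ + k₂ - 1, ⟨D₁ ∪ D₂, (card_union_le _ _).trans (by omega), ?_⟩, ?_⟩
  · refine not_hasLongCycle_residual_union hd
      ((numCross_mono residual_subset residual_subset).trans hx.le) (fun h => hl₁ (h.mono ?_))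
      (fun h => hl₂ (h.mono (residual_mono subset_rfl subset_union_right)))
    intro v hv
    simp only [mem_residual, mem_union, not_or, mem_erase] at hv ⊢
    exact ⟨⟨by rintro rfl; exact hv.2.2 b (.inr hbD) hab.symm, hv.1⟩, hv.2.1.1,
      fun d hd => hv.2.2 d (.inl hd)⟩
  · rw [numEdges_union hd]
    omega

lemma hasSlack_or_isExtremal_of_bridge (hd : Disjoint A B) (hA : A.Nonempty) (hB : B.Nonempty)
    (hx : numCross G A B = 1) (h₁ : HasSlack G A ∨ IsExtremal G A)
    (h₂ : HasSlack G B ∨ IsExtremal G B) : HasSlack G (A ∪ B) ∨ IsExtremal G (A ∪ B) := by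
  have key : ∀ k l, CanIsolate G A k → CanIsolate G B l →
      6 * (k + l) ≤ numEdges G A + numEdges G B + 1 → HasSlack G (A ∪ B) := fun k l hk hl hkl =>
    ⟨k + l, hk.union hl hd hx.le, by rw [numEdges_union hd]; omega⟩
  obtain ⟨k', hk', hke'⟩ := exists_canIsolate h₁ hA
  obtain ⟨l', hl', hle'⟩ := exists_canIsolate h₂ hB
  rcases h₁ with ⟨k, hk, hke⟩ | h₁
  · exact .inl (key k l' hk hl' (by omega))
  rcases h₂ with ⟨l, hl, hle⟩ | h₂
  · exact .inl (key k' l hk' hl (by omega))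
  obtain ⟨Q₁, k₁, ht₁, hQ₁⟩ := h₁.isTight
  obtain ⟨Q₂, k₂, ht₂, hQ₂⟩ := h₂.isTight
  obtain ⟨a, ha, b, hb, hab⟩ := exists_adj_of_numCross_pos (by omega : 0 < numCross G A B)
  by_cases haQ : a ∈ Q₁
  · by_cases hbQ : b ∈ Q₂
    · refine .inr (.inr ⟨_, (hQ₁ ⟨a, haQ⟩).join (hQ₂ ⟨b, hbQ⟩) hd hx ?_⟩)
      have := numCross_mono (G := G) ht₁.subset ht₂.subset
      have := numCross_pos haQ hbQ hab
      omega
    · rw [union_comm]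
      exact .inl (hasSlack_of_bridge_not_mem ht₂ ht₁ hd.symm (by rwa [numCross_comm]) hb ha hab.symm
        hbQ)
  · exact .inl (hasSlack_of_bridge_not_mem ht₁ ht₂ hd hx ha hb hab haQ)

/-- A square `B` that hangs on a bridge ending in `y`. The vertex `y` breaks the square, and also
every square that is a component of the rest. The hypothesis `hH` says that the other components are
not attached to `y` by bridges; the edges at `y` then pay for the choice of `y`, with one edge to
spare as soon as there is any such component. -/
lemma hasSlack_or_isExtremal_of_pendant_square (hd : Disjoint A B) (hA : ConnectedOn G A)
    (hB : IsSquare G B) (hx : numCross G A B = 1) {y w : V} (hy : y ∈ A) (hw : w ∈ B)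
    (hyw : G.Adj y w)
    (hH : ∀ H, IsComponent G H (A.erase y) → ¬ IsSquare G H →
      2 ≤ numCross G {y} H ∧ (HasSlack G H ∨ IsExtremal G H)) :
    HasSlack G (A ∪ B) ∨ IsExtremal G (A ∪ B) := by
  have hyB : y ∉ B := disjoint_left.1 hd hy
  have hxy : numCross G {y} B = 1 := by
    have := numCross_mono (G := G) (singleton_subset_iff.2 hy) (subset_refl B)
    have := numCross_pos (mem_singleton_self y) hw hyw
    omega
  rcases (A.erase y).eq_empty_or_nonempty with hW | hW
  · have hAy : A = {y} := by rw [← insert_erase hy, hW]; rfl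
    subst hAy
    exact .inr (.inr ⟨{y}, .single hB hyB hxy⟩)
  left
  obtain ⟨k, ⟨D, hDk, hDl⟩, -, hke⟩ := canIsolate_of_components (G := G) (N := {y})
    (M := {v ∈ A | G.Adj y v}) (W := A.erase y) (by
      intro H hHW
      by_cases hsq : IsSquare G H
      · have hpos : 0 < numCross G {y} H := by
          have hne : H ≠ A := by
            rintro rfl
            exact notMem_erase y _ (hHW.1 hy)
          obtain ⟨a, ha, b, hb, hab⟩ := exists_adj_of_numCross_pos
            (hA.2 H (hHW.1.trans (erase_subset _ _)) hHW.2.1.1 hne)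
          have hby : b = y := by
            by_contra hby
            refine numCross_eq_zero_iff.1 hHW.2.2 a ha b ?_ hab
            simp only [mem_sdiff, mem_erase] at hb ⊢
            exact ⟨⟨hby, hb.1⟩, hb.2⟩
          subst hby
          exact numCross_pos (mem_singleton_self _) ha hab.symm
        refine ⟨0, canIsolate_of_not_hasLongCycle (fun hL => ?_) 0, by omega⟩
        obtain ⟨y', hy', b, hb, hyb⟩ := exists_adj_of_numCross_pos hpos
        rw [mem_singleton] at hy'
        subst hy'
        have hsub : H \ {v ∈ A | G.Adj y' v} ⊆ H.erase b := by
          intro v hv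
          simp only [mem_sdiff, mem_filter, not_and] at hv
          refine mem_erase.2 ⟨?_, hv.1⟩
          rintro rfl
          exact hv.2 (erase_subset _ _ (hHW.1 hb)) hyb
        exact not_hasLongCycle_of_subset_erase hsq.card_eq.le hb hsub hL
      · obtain ⟨h2, h⟩ := hH H hHW hsq
        obtain ⟨k, hk, hke⟩ := exists_canIsolate h hHW.2.1.1
        exact ⟨k, hk.mono sdiff_subset, by omega⟩)
  have hke := hke hW
  refine ⟨k + 1, ⟨insert y D, (card_insert_le _ _).trans (by omega), ?_⟩, ?_⟩
  · refine not_hasLongCycle_residual_union hd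
      ((numCross_mono residual_subset residual_subset).trans hx.le) (fun h => hDl (h.mono ?_))
      (fun h => ?_)
    · intro v hv
      simp only [mem_residual, mem_insert, not_or, forall_eq_or_imp, mem_sdiff, mem_erase,
        mem_filter] at hv ⊢
      tauto
    · have hsub : residual G B (insert y D) ⊆ B.erase w := by
        intro v hv
        simp only [mem_residual, mem_insert, not_or, forall_eq_or_imp] at hv
        refine mem_erase.2 ⟨?_, hv.1⟩
        rintro rfl
        exact hv.2.2.1 hyw
      exact not_hasLongCycle_of_subset_erase hB.card_eq.le hw hsub h
  · have h1 := numEdges_erase_add (G := G) hy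
    have h2 : numCross G {y} (A.erase y) ≤ numCross G {y} A :=
      numCross_mono subset_rfl (erase_subset _ _)
    rw [numEdges_union hd, hB.numEdges_eq, hx]
    omega

/-! ### Bridgeless sets -/

/-- A square joined to the rest `E` by two or three edges. One of the vertices of the square
dominates two of the ends of these edges, so that at most one edge remains. If there are only two
edges and `E` is extremal, prescribing an end of one of them on the side of `E` even makes the
square free. -/
lemma hasSlack_of_square {E : Finset V} (hd : Disjoint K E) (hK : IsSquare G K) (hE : E.Nonempty)
    (h : HasSlack G E ∨ IsExtremal G E) (h2 : 2 ≤ numCross G K E) (h3 : numCross G K E ≤ 3) :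
    HasSlack G (K ∪ E) := by
  have he := numEdges_union (G := G) hd
  rw [hK.numEdges_eq] at he
  -- Few vertices of `K` remain once `K` is met.
  have hKl : ∀ D : Finset V, ∀ v ∈ K, v ∉ residual G K D → ¬ HasLongCycle G (residual G K D) := by
    intro D v hv hvD
    exact not_hasLongCycle_of_subset_erase hK.card_eq.le hv
      fun u hu => mem_erase.2 ⟨by rintro rfl; exact hvD hu, residual_subset hu⟩
  have key : ∀ k, CanIsolate G E k → CanIsolate G (K ∪ E) (k + 1) := by
    rintro k ⟨D, hDk, hDl⟩
    obtain ⟨⟨u, u'⟩, hu, ⟨v, v'⟩, hv, huv⟩ := one_lt_card.1 (show 1 < #(G.interedges K E) from h2)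
    rw [SimpleGraph.mk_mem_interedges_iff] at hu hv
    obtain ⟨a, ha, hau, hav⟩ := hK.exists_dominating hu.1 hv.1
    refine ⟨insert a D, (card_insert_le _ _).trans (by omega),
      not_hasLongCycle_residual_union hd ?_ (hKl _ a ha (by simp [mem_residual]))
        (fun hL => hDl (hL.mono (residual_mono subset_rfl (subset_insert _ _))))⟩
    have hres : ∀ z, (z = a ∨ G.Adj a z) → z ∉ residual G K (insert a D) := by
      rintro z (rfl | hz) hzr
      · simp [mem_residual] at hzr
      · simp only [mem_residual, mem_insert, forall_eq_or_imp] at hzr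
        exact hzr.2.2.1 hz
    have hsub : G.interedges (residual G K (insert a D)) (residual G E (insert a D)) ⊆
        ((G.interedges K E).erase (u, u')).erase (v, v') := by
      rintro ⟨p, q⟩ hpq
      rw [SimpleGraph.mk_mem_interedges_iff] at hpq
      simp only [mem_erase, ne_eq, Prod.mk.injEq, SimpleGraph.mk_mem_interedges_iff]
      refine ⟨?_, ?_, residual_subset hpq.1, residual_subset hpq.2.1, hpq.2.2⟩
      · rintro ⟨rfl, -⟩
        exact hres _ hav hpq.1
      · rintro ⟨rfl, -⟩
        exact hres _ hau hpq.1
    have := card_le_card hsub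
    rw [card_erase_of_mem (mem_erase.2 ⟨huv.symm, by simp [SimpleGraph.mk_mem_interedges_iff, hv]⟩),
      card_erase_of_mem (by simp [SimpleGraph.mk_mem_interedges_iff, hu])] at this
    unfold numCross at h3 ⊢
    omega
  rcases h with ⟨k, hk, hke⟩ | h
  · exact ⟨k + 1, key k hk, by omega⟩
  obtain ⟨Q, k, ht, -⟩ := h.isTight
  have hke := ht.edges
  rcases Nat.lt_or_ge 2 (numCross G K E) with h4 | h4
  · exact ⟨k + 1, key k (ht.canIsolate hE), by omega⟩
  obtain ⟨a, ha, y, hy, hay⟩ := exists_adj_of_numCross_pos (by omega : 0 < numCross G K E)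
  obtain ⟨D, hyD, hDk, hDl⟩ := ht.exists_mem y hy
  have hyr : y ∉ residual G E D := by simp [mem_residual, hyD]
  have har : a ∉ residual G K D := by
    simp only [mem_residual, not_and, not_forall, not_not]
    exact fun _ _ => ⟨y, hyD, hay.symm⟩
  refine ⟨k, ⟨D, hDk, not_hasLongCycle_residual_union hd ?_ (hKl D a ha har) hDl⟩, by omega⟩
  have := numCross_lt (G := G) (residual_subset (G := G) (T := K) (D := D))
    (residual_subset (G := G) (T := E) (D := D)) ha hy hay (.inl har)
  omega

/-- In a connected set, a vertex of degree at least three exists as soon as some vertex avoids some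
long cycle. -/
lemma ConnectedOn.exists_three_le (hS : ConnectedOn G S) {v : V} (hv : v ∈ S)
    (hL : HasLongCycle G (S.erase v)) : ∃ x ∈ S, 3 ≤ numCross G {x} S := by
  obtain ⟨n, c, hc, ha, hm⟩ := hL
  have hTS : univ.image c ⊆ S := by
    intro x hx
    obtain ⟨i, -, rfl⟩ := mem_image.1 hx
    exact erase_subset _ _ (hm i)
  have hne : univ.image c ≠ S := by
    rintro h
    rw [← h] at hv
    obtain ⟨i, -, rfl⟩ := mem_image.1 hv
    exact notMem_erase _ _ (hm i)
  obtain ⟨x, hx, b, hb, hxb⟩ := exists_adj_of_numCross_pos (hS.2 _ hTS (by simp) hne)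
  obtain ⟨i, -, rfl⟩ := mem_image.1 hx
  refine ⟨c i, hTS hx, ?_⟩
  rw [mem_sdiff] at hb
  have hbc : ∀ j, b ≠ c j := fun j h => hb.2 (mem_image.2 ⟨j, mem_univ _, h.symm⟩)
  have h1 := ha (i - 1)
  rw [sub_add_cancel] at h1
  have h2 : c (i - 1) ≠ c (i + 1) := by
    refine hc.ne fun h => fin_add_two_ne (i - 1) ?_
    rw [sub_add_cancel, h]
  rw [numCross_singleton_left]
  have : #{b, c (i - 1), c (i + 1)} = 3 := by
    rw [card_insert_of_notMem (by simp [hbc]), card_pair h2]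
  rw [← this]
  refine card_le_card fun z hz => ?_
  simp only [mem_insert, mem_singleton] at hz
  rw [mem_filter]
  rcases hz with rfl | rfl | rfl
  · exact ⟨hb.1, hxb⟩
  · exact ⟨erase_subset _ _ (hm _), h1.symm⟩
  · exact ⟨erase_subset _ _ (hm _), ha i⟩

/-- Vertices with at most one neighbour in `S` lie on no cycle in `S`. -/
lemma HasLongCycle.sdiff (hS : HasLongCycle G S) {X : Finset V}
    (h : ∀ v ∈ X, numCross G {v} S ≤ 1) : HasLongCycle G (S \ X) := by
  induction X using Finset.induction_on with
  | empty => simpa using hS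
  | insert b X hb ih =>
    rw [sdiff_insert]
    exact (ih fun v hv => h v (mem_insert_of_mem hv)).erase
      ((numCross_mono subset_rfl sdiff_subset).trans (h b (mem_insert_self _ _)))

lemma numCross_eq_sum (A B : Finset V) : numCross G A B = ∑ a ∈ A, numCross G {a} B := by
  induction A using Finset.induction_on with
  | empty => simp [numCross]
  | insert a A ha ih =>
    rw [sum_insert ha, insert_eq, numCross_union_left (by simpa using ha), ih]

/-- Choosing in the extremal set `K` the end `b` of an edge `ba` makes `K` contribute nothing new,
removes `a` from `R`, and leaves at most one of two edges between `K` and `R`. -/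
lemma not_hasLongCycle_of_two_edges (hd : Disjoint K R) (h2 : numCross G K R ≤ 2) {a b : V}
    (hb : b ∈ K) (ha : a ∈ R) (hba : G.Adj b a) (hbD : b ∈ D)
    (hK : ¬ HasLongCycle G (residual G K D)) (hR : ¬ HasLongCycle G (residual G R D)) :
    ¬ HasLongCycle G (residual G (K ∪ R) D) := by
  refine not_hasLongCycle_residual_union hd ?_ hK hR
  have := numCross_lt (G := G) (residual_subset (G := G) (T := K) (D := D))
    (residual_subset (G := G) (T := R) (D := D)) hb ha hba (.inl (by simp [mem_residual, hbD]))
  omega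

lemma not_hasLongCycle_residual_of_card_le (hR : #R ≤ 4) {a b : V} (ha : a ∈ R)
    (hba : G.Adj b a) (hbD : b ∈ D) : ¬ HasLongCycle G (residual G R D) := by
  refine not_hasLongCycle_of_subset_erase hR ha fun v hv => ?_
  rw [mem_residual] at hv
  exact mem_erase.2 ⟨by rintro rfl; exact hv.2.2 b hbD hba, hv.1⟩

/-- An extremal set joined by two edges to at most four vertices: no vertex has to be added. -/
lemma hasSlack_of_extremal_two (hd : Disjoint K R) (hK : IsExtremal G K)
    (h2 : numCross G K R = 2) (hR : #R ≤ 4) : HasSlack G (K ∪ R) := by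
  obtain ⟨Q, k, ht, -⟩ := hK.isTight
  obtain ⟨b, hb, a, ha, hba⟩ := exists_adj_of_numCross_pos (by omega : 0 < numCross G K R)
  obtain ⟨D, hbD, hDk, hDl⟩ := ht.exists_mem b hb
  refine ⟨k, ⟨D, hDk, not_hasLongCycle_of_two_edges hd h2.le hb ha hba hbD hDl
    (not_hasLongCycle_residual_of_card_le hR ha hba hbD)⟩, ?_⟩
  rw [numEdges_union hd, ht.edges]
  omega

lemma hasSlack_of_extremal_two_two {K₁ K₂ : Finset V} (hd₁ : Disjoint K₁ (K₂ ∪ R))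
    (hd₂ : Disjoint K₂ R) (hK₁ : IsExtremal G K₁) (hK₂ : IsExtremal G K₂)
    (h₁ : numCross G K₁ (K₂ ∪ R) = 2) (h₂ : numCross G K₂ R = 2) (hR : #R ≤ 4) :
    HasSlack G (K₁ ∪ (K₂ ∪ R)) := by
  obtain ⟨Q₁, k₁, ht₁, -⟩ := hK₁.isTight
  obtain ⟨Q₂, k₂, ht₂, -⟩ := hK₂.isTight
  obtain ⟨b₁, hb₁, a₁, ha₁, hba₁⟩ :=
    exists_adj_of_numCross_pos (by omega : 0 < numCross G K₁ (K₂ ∪ R))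
  obtain ⟨b₂, hb₂, a₂, ha₂, hba₂⟩ := exists_adj_of_numCross_pos (by omega : 0 < numCross G K₂ R)
  obtain ⟨D₁, hbD₁, hDk₁, hDl₁⟩ := ht₁.exists_mem b₁ hb₁
  obtain ⟨D₂, hbD₂, hDk₂, hDl₂⟩ := ht₂.exists_mem b₂ hb₂
  have e₁ := ht₁.edges
  have e₂ := ht₂.edges
  refine ⟨k₁ + k₂, ⟨D₁ ∪ D₂, (card_union_le _ _).trans (by omega), ?_⟩, ?_⟩
  · exact not_hasLongCycle_of_two_edges hd₁ h₁.le hb₁ ha₁ hba₁ (mem_union_left _ hbD₁)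
      (fun h => hDl₁ (h.mono (residual_mono subset_rfl subset_union_left)))
      (not_hasLongCycle_of_two_edges hd₂ h₂.le hb₂ ha₂ hba₂ (mem_union_right _ hbD₂)
        (fun h => hDl₂ (h.mono (residual_mono subset_rfl subset_union_right)))
        (not_hasLongCycle_residual_of_card_le hR ha₂ hba₂ (mem_union_right _ hbD₂)))
  · rw [numEdges_union hd₁, numEdges_union hd₂]
    omega

/-- A claw with centre `x` whose three leaves have one neighbour each in the extremal set `K`.
Either one of these neighbours can be traded for the leaf adjacent to it, or all of them lie in
`Q`. -/
lemma hasSlack_of_extremal_claw {x : V} (hd : Disjoint K (insert x N)) (hxN : x ∉ N)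
    (hx : ∀ a ∈ N, G.Adj x a) (hxK : numCross G {x} K = 0) (hN : #N = 3) (hNe : numEdges G N = 0)
    (hK : IsExtremal G K) (h1 : ∀ a ∈ N, numCross G {a} K = 1) :
    HasSlack G (K ∪ insert x N) := by
  obtain ⟨Q, k, ht, -⟩ := hK.isTight
  have hKN : numCross G N K = 3 := by
    rw [numCross_eq_sum, sum_congr rfl h1]
    simp [hN]
  have he : numEdges G (K ∪ insert x N) = 6 * k + 5 := by
    have hxN' : numCross G {x} N = 3 := by
      rw [numCross_singleton_left, filter_true_of_mem hx, hN]
    rw [numEdges_union hd, numEdges_insert hxN, hNe, hxN', numCross_comm, insert_eq,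
      numCross_union_left (by simpa using hxN), hxK, hKN, ht.edges]
  have hNadj : ∀ a ∈ N, numCross G {a} N = 0 := fun a ha => by
    have := numEdges_erase_add (G := G) ha
    omega
  by_cases hQ : ∃ a ∈ N, ∃ b ∈ K, G.Adj a b ∧ b ∉ Q
  · -- Trade `b` for `a`: the other two leaves then hang on `K` by one edge each.
    obtain ⟨a, ha, b, hb, hab, hbQ⟩ := hQ
    obtain ⟨D, hDk, hDl⟩ := ht.exists_erase b hb hbQ
    refine ⟨k, ⟨insert a D, (card_insert_le _ _).trans hDk, fun hL => ?_⟩, by omega⟩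
    have hsub : residual G (K ∪ insert x N) (insert a D) ⊆
        residual G (K.erase b) D ∪ N.erase a := by
      intro v hv
      simp only [mem_residual, mem_union, mem_insert, not_or, forall_eq_or_imp, mem_erase] at hv ⊢
      obtain ⟨hv | rfl | hv, ⟨h2, h3⟩, h4, h5⟩ := hv
      · exact .inl ⟨⟨by rintro rfl; exact h4 hab, hv⟩, h3, h5⟩
      · exact absurd (hx a ha).symm h4
      · exact .inr ⟨h2, hv⟩
    refine hDl (((hL.mono hsub).sdiff (X := N.erase a) fun v hv => ?_).mono ?_)
    · have hvN := erase_subset _ _ hv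
      have hd' : Disjoint (residual G (K.erase b) D) (N.erase a) :=
        disjoint_of_subset_left (residual_subset.trans (erase_subset _ _))
          (disjoint_of_subset_right ((erase_subset _ _).trans (subset_insert _ _)) hd)
      rw [numCross_union_right hd']
      have h0 := hNadj v hvN
      have := numCross_mono (G := G) (subset_refl {v}) (erase_subset a N)
      have := numCross_mono (G := G) (subset_refl {v})
        ((residual_subset (G := G) (T := K.erase b) (D := D)).trans (erase_subset _ _))
      have := h1 v hvN
      omega
    · intro v hv
      simp only [mem_sdiff, mem_union] at hv
      tauto
  · -- All three leaves are dominated by `Q`.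
    push Not at hQ
    have hdom : ∀ a ∈ N, a ∉ residual G (insert x N) Q := by
      intro a ha har
      obtain ⟨a', ha', b, hb, hab⟩ := exists_adj_of_numCross_pos
        (by rw [h1 a ha]; omega : 0 < numCross G {a} K)
      rw [mem_singleton] at ha'
      subst ha'
      exact (mem_residual.1 har).2.2 b (hQ _ ha b hb hab) hab.symm
    have hres : residual G (insert x N) Q ⊆ {x} := by
      intro v hv
      rcases mem_insert.1 (residual_subset hv) with rfl | h
      · simp
      · exact absurd hv (hdom v h)
    have hQne : Q.Nonempty := by
      obtain ⟨a, ha, b, hb, hab⟩ := exists_adj_of_numCross_pos (by omega : 0 < numCross G N K)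
      exact ⟨b, hQ a ha b hb hab⟩
    obtain ⟨hQk, hQl⟩ := ht.of_nonempty hQne
    refine ⟨k, ⟨Q, hQk, not_hasLongCycle_residual_union hd ?_ hQl fun h => ?_⟩, by omega⟩
    · have := numCross_mono (G := G) (residual_subset (G := G) (T := K) (D := Q)) hres
      rw [numCross_comm K, hxK] at this
      omega
    · have := (h.mono hres).four_le_card
      simp at this

/-- A claw with centre `x` whose leaves have four neighbours altogether in a square: one leaf
dominates half of the square. -/
lemma exists_not_hasLongCycle_of_square_claw {x : V} (hd : Disjoint K N) (hx : ∀ a ∈ N, G.Adj x a)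
    (hN : #N = 3) (hNe : numEdges G N = 0) (hK : IsSquare G K) (h4 : numCross G N K = 4)
    (h1 : ∀ a ∈ N, 1 ≤ numCross G {a} K) :
    ∃ a ∈ N, ¬ HasLongCycle G (residual G (K ∪ insert x N) {a}) := by
  have hNadj : ∀ a ∈ N, numCross G {a} N = 0 := fun a ha => by
    have := numEdges_erase_add (G := G) ha
    omega
  rw [numCross_eq_sum] at h4
  obtain ⟨a, ha, h2⟩ : ∃ a ∈ N, 1 < numCross G {a} K := by
    refine exists_lt_of_sum_lt (f := fun _ => 1) ?_
    simp [hN, h4]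
  refine ⟨a, ha, fun hL => ?_⟩
  have hrest : ∀ b ∈ N.erase a, numCross G {b} K ≤ 1 := by
    intro b hb
    by_contra hcon
    have hlt : ∑ i ∈ N.erase a, 1 < ∑ i ∈ N.erase a, numCross G {i} K :=
      sum_lt_sum (fun i hi => h1 i (erase_subset _ _ hi)) ⟨b, hb, by omega⟩
    rw [← add_sum_erase _ _ ha] at h4
    simp [card_erase_of_mem ha, hN] at hlt
    omega
  have hsub : residual G (K ∪ insert x N) {a} ⊆ (K \ {b ∈ K | G.Adj a b}) ∪ N.erase a := by
    intro v hv
    simp only [mem_residual, mem_union, mem_insert, mem_singleton, forall_eq] at hv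
    simp only [mem_union, mem_sdiff, mem_filter, mem_erase]
    obtain ⟨hv | rfl | hv, h3, h4⟩ := hv
    · exact .inl ⟨hv, fun h => h4 h.2⟩
    · exact absurd (hx a ha).symm h4
    · exact .inr ⟨h3, hv⟩
  have hL' := (hL.mono hsub).sdiff (X := N.erase a) fun v hv => by
    have hd' : Disjoint (K \ {b ∈ K | G.Adj a b}) (N.erase a) :=
      disjoint_of_subset_left sdiff_subset (disjoint_of_subset_right (erase_subset _ _) hd)
    rw [numCross_union_right hd']
    have h0 := hNadj v (erase_subset _ _ hv)
    have := numCross_mono (G := G) (subset_refl {v}) (erase_subset a N)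
    have := numCross_mono (G := G) (subset_refl {v})
      (sdiff_subset (s := K) (t := {b ∈ K | G.Adj a b}))
    have := hrest v hv
    omega
  have h5 : HasLongCycle G (K \ {b ∈ K | G.Adj a b}) := hL'.mono fun v hv => by
    simp only [mem_sdiff, mem_union] at hv ⊢
    tauto
  have := h5.four_le_card
  have := card_sdiff_add_card_eq_card (filter_subset (fun b => G.Adj a b) K)
  rw [numCross_singleton_left] at h2
  have := hK.card_eq
  omega

/-- The bridgeless case. For a vertex `x` of degree at least three, the components of `S` without
the closed neighbourhood `{x} ∪ N` are joined to `N` by at least two edges each. Counting these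
edges pays for `x`, except in a few configurations in which one more vertex can be saved. -/
lemma hasSlack_or_isExtremal_of_bridgeless (hS : ConnectedOn G S) (hL : HasLongCycle G S)
    (he : 5 ≤ numEdges G S)
    (h2 : ∀ A ⊆ S, A.Nonempty → A ≠ S → 2 ≤ numCross G A (S \ A))
    (ih : ∀ H, H ⊂ S → ConnectedOn G H → ¬ IsSquare G H → HasSlack G H ∨ IsExtremal G H) :
    HasSlack G S ∨ IsExtremal G S := by
  have hdeg : ∀ v ∈ S, 2 ≤ numCross G {v} S := by
    intro v hv
    have h4 := hL.four_le_card
    refine (h2 {v} (by simpa using hv) (by simp) ?_).trans (numCross_mono subset_rfl sdiff_subset)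
    rintro rfl
    simp at h4
  by_cases hone : ∃ x ∈ S, ¬ HasLongCycle G (residual G S {x})
  · obtain ⟨x, -, hx⟩ := hone
    rcases eq_or_lt_of_le he with he | he
    · exact .inr (.inl ⟨he.symm, hdeg⟩)
    · exact .inl ⟨1, ⟨{x}, by simp, hx⟩, by omega⟩
  push Not at hone
  left
  by_contra hno
  obtain ⟨x, hx, hdx⟩ : ∃ x ∈ S, 3 ≤ numCross G {x} S := by
    obtain ⟨v, hv⟩ := hS.1
    exact hS.exists_three_le hv ((hone v hv).mono (residual_singleton_subset v))
  -- The neighbourhood `N` of `x` in `S` and the rest `W` of `S`.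
  rw [numCross_singleton_left] at hdx
  obtain ⟨N, hNdef⟩ : ∃ N, N = {b ∈ S | G.Adj x b} := ⟨_, rfl⟩
  rw [← hNdef] at hdx
  have hmN : ∀ b, b ∈ N ↔ b ∈ S ∧ G.Adj x b := by simp [hNdef]
  have hxN : x ∉ N := by simp [hmN]
  have hNS : insert x N ⊆ S := by
    intro v hv
    rcases mem_insert.1 hv with rfl | h
    exacts [hx, ((hmN v).1 h).1]
  obtain ⟨W, hWdef⟩ : ∃ W, W = S \ insert x N := ⟨_, rfl⟩
  have hWS : W ⊆ S := hWdef ▸ sdiff_subset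
  have hWN : Disjoint W (insert x N) := hWdef ▸ sdiff_disjoint
  have hSW : S \ W = insert x N := by rw [hWdef, Finset.sdiff_sdiff_eq_self hNS]
  have hmW : ∀ v, v ∈ S → v ∉ W → v ∈ insert x N := fun v h1 h2 => hSW ▸ mem_sdiff.2 ⟨h1, h2⟩
  have hxW : ∀ v ∈ W, ¬ G.Adj x v := fun v hv h =>
    disjoint_left.1 hWN hv (mem_insert_of_mem ((hmN v).2 ⟨hWS hv, h⟩))
  have hxW0 : ∀ H ⊆ W, numCross G {x} H = 0 := by
    intro H hH
    rw [numCross_eq_zero_iff]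
    intro u hu v hv
    rw [mem_singleton] at hu
    subst hu
    exact hxW v (hH hv)
  have hRH : ∀ H ⊆ W, numCross G (insert x N) H = numCross G N H := by
    intro H hH
    rw [insert_eq, numCross_union_left (by simpa using hxN), hxW0 H hH, zero_add]
  have heS : numEdges G S = #N + numEdges G N + numEdges G W + numCross G N W := by
    have h1 := numEdges_add_sdiff (G := G) hNS
    have hxN' : numCross G {x} N = #N := by
      rw [numCross_singleton_left, filter_true_of_mem fun a ha => ((hmN a).1 ha).2]
    rw [← hWdef, hRH W subset_rfl, numEdges_insert hxN, hxN'] at h1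
    omega
  have hresW : residual G S {x} ⊆ W := by
    intro v hv
    simp only [mem_residual, mem_singleton, forall_eq] at hv
    by_contra hvW
    rcases mem_insert.1 (hmW v hv.1 hvW) with h | h
    · exact hv.2.1 h
    · exact hv.2.2 ((hmN v).1 h).2
  have hLW : HasLongCycle G W := (hone x hx).mono hresW
  -- It is enough to isolate `W` with six edges to spare.
  have finish : ∀ k, CanIsolate G W k → ¬ 6 * k + 6 ≤ numEdges G S := by
    rintro k ⟨D, hDk, hDl⟩ hk
    refine hno ⟨k + 1, ⟨insert x D, (card_insert_le _ _).trans (by omega),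
      fun h => hDl (h.mono ?_)⟩, by omega⟩
    intro v hv
    simp only [mem_residual, mem_insert, not_or, forall_eq_or_imp] at hv ⊢
    exact ⟨hresW (by simpa [mem_residual] using ⟨hv.1, hv.2.1.1, hv.2.2.1⟩), hv.2.1.2, hv.2.2.2⟩
  have hcross : ∀ H, IsComponent G H W → numCross G H (S \ H) = numCross G N H := by
    intro H hH
    have h1 : S \ H = (W \ H) ∪ insert x N := by
      rw [← hSW, union_comm, sdiff_union_sdiff_cancel hWS hH.1]
    rw [h1, numCross_union_right (disjoint_of_subset_left sdiff_subset hWN), hH.2.2, numCross_comm,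
      hRH H hH.1, zero_add]
  have hHx : ∀ H, IsComponent G H W → x ∈ S \ H := fun H hH =>
    mem_sdiff.2 ⟨hx, fun h => disjoint_left.1 hWN (hH.1 h) (mem_insert_self _ _)⟩
  have hHS : ∀ H, IsComponent G H W → H ⊂ S := fun H hH =>
    (ssubset_iff_of_subset (hH.1.trans hWS)).2 ⟨x, hx, (mem_sdiff.1 (hHx H hH)).2⟩
  have htwo : ∀ H, IsComponent G H W → 2 ≤ numCross G N H := fun H hH =>
    hcross H hH ▸ h2 H (hHS H hH).1 hH.2.1.1 (hHS H hH).ne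
  -- Squares joined to `N` by at most three edges have been dealt with.
  have hsq : ∀ H, IsComponent G H W → IsSquare G H → 4 ≤ numCross G N H := by
    intro H hH hHsq
    by_contra hlt
    have hE : ¬ IsSquare G (S \ H) := by
      intro hE
      have hsub : insert x N ⊆ S \ H := fun v hv =>
        mem_sdiff.2 ⟨hNS hv, fun h => disjoint_left.1 hWN (hH.1 h) hv⟩
      have heq : insert x N = S \ H := eq_of_subset_of_card_le hsub
        (by rw [hE.card_eq, card_insert_of_notMem hxN]; omega)
      obtain ⟨u, hu, hux, hxu⟩ := hE.exists_not_adj (hHx H hH)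
      rw [← heq] at hu
      exact hxu ((hmN u).1 ((mem_insert.1 hu).resolve_left hux)).2
    have hconn : ConnectedOn G (S \ H) := hS.sdiff_component hWS hH
      (by rw [hSW]; exact mem_insert_self _ _)
      (fun y hy hyx => ((hmN y).1 ((mem_insert.1 (hSW ▸ hy)).resolve_left hyx)).2)
    have hss : S \ H ⊂ S := sdiff_ssubset (hHS H hH).1 hH.2.1.1
    have := hasSlack_of_square disjoint_sdiff hHsq ⟨x, hHx H hH⟩ (ih _ hss hconn hE)
      (by rw [hcross H hH]; exact htwo H hH) (by rw [hcross H hH]; omega)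
    rw [union_sdiff_of_subset (hHS H hH).1] at this
    exact hno this
  -- A component saves two edges, or it is extremal, joined to `N` by two edges, and saves one.
  have hcomp : ∀ H, IsComponent G H W →
      (∃ k, CanIsolate G H k ∧ 6 * k + 2 ≤ numEdges G H + numCross G N H) ∨
        (IsExtremal G H ∧ numCross G N H = 2) := by
    intro H hH
    have h2H := htwo H hH
    by_cases hHsq : IsSquare G H
    · have := hsq H hH hHsq
      exact .inl ⟨1, hHsq.canIsolate_one, by rw [hHsq.numEdges_eq]; omega⟩
    · rcases ih H (hHS H hH) hH.2.1 hHsq with ⟨k, hk, hke⟩ | hext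
      · exact .inl ⟨k, hk, by omega⟩
      · rcases eq_or_lt_of_le h2H with h | h
        · exact .inr ⟨hext, h.symm⟩
        · obtain ⟨Q, k, ht, -⟩ := hext.isTight
          have := ht.edges
          exact .inl ⟨k, ht.canIsolate hH.2.1.1, by omega⟩
  have hcomp1 : ∀ H, IsComponent G H W →
      ∃ k, CanIsolate G (H \ ∅) k ∧ 6 * k + 1 ≤ numEdges G H + numCross G N H := by
    intro H hH
    rw [sdiff_empty]
    rcases hcomp H hH with ⟨k, hk, hke⟩ | ⟨hext, h⟩
    · exact ⟨k, hk, by omega⟩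
    · obtain ⟨Q, k, ht, -⟩ := hext.isTight
      have := ht.edges
      exact ⟨k, ht.canIsolate hH.2.1.1, by omega⟩
  have hsplit : ∀ H X : Finset V, H ⊆ X → numCross G H (X \ H) = 0 →
      numEdges G X + numCross G N X = (numEdges G H + numCross G N H) +
        (numEdges G (X \ H) + numCross G N (X \ H)) := by
    intro H X hHX h0
    have h1 := numEdges_add_sdiff (G := G) hHX
    have h3 : numCross G N X = numCross G N H + numCross G N (X \ H) := by
      rw [← numCross_union_right disjoint_sdiff, union_sdiff_of_subset hHX]
    omega
  have hglue : ∀ H X : Finset V, H ⊆ X → numCross G H (X \ H) = 0 → ∀ k l, CanIsolate G H k →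
      CanIsolate G (X \ H) l → CanIsolate G X (k + l) := by
    intro H X hHX h0 k l hk hl
    have := hk.union hl disjoint_sdiff (by omega)
    rwa [union_sdiff_of_subset hHX] at this
  obtain ⟨K, hK, hKL⟩ := exists_isComponent_hasLongCycle hLW
  have hWK := hsplit K W hK.1 hK.2.2
  have hSK : K ∪ (S \ K) = S := union_sdiff_of_subset (hHS K hK).1
  -- `l` vertices are enough for the other components.
  obtain ⟨l, hl, hle, hle1⟩ := canIsolate_of_components (G := G) (N := N) (M := ∅) (W := W \ K)
    (fun H hH => hcomp1 H (hK.of_sdiff hH))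
  rw [sdiff_empty] at hl
  have finishK : ∀ k, CanIsolate G K k →
      ¬ 6 * k + 6 ≤ #N + numEdges G N + (numEdges G K + numCross G N K) := by
    intro k hk h
    exact finish _ (hglue K W hK.1 hK.2.2 k l hk hl) (by omega)
  have finishK1 : (W \ K).Nonempty → ∀ k, CanIsolate G K k →
      ¬ 6 * k + 5 ≤ #N + numEdges G N + (numEdges G K + numCross G N K) := by
    intro hne k hk h
    have := hle1 hne
    exact finish _ (hglue K W hK.1 hK.2.2 k l hk hl) (by omega)
  -- If `K` is the only component and `N` spans no edge, every vertex of `N` has an edge to `K`.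
  have hone_le : W \ K = ∅ → numEdges G N = 0 → ∀ a ∈ N, 1 ≤ numCross G {a} K := by
    intro hW0 hN0 a ha
    have hKW : K = W := subset_antisymm hK.1 (sdiff_eq_empty_iff_subset.1 hW0)
    have haS := ((hmN a).1 ha).1
    have h3 : 2 ≤ numCross G {a} S := hdeg a haS
    have h4 : S = K ∪ ({x} ∪ N) := by
      rw [hKW, ← insert_eq, ← hSW, union_sdiff_of_subset hWS]
    have hd1 : Disjoint K ({x} ∪ N) := by rw [← insert_eq, hKW]; exact hWN
    rw [h4, numCross_union_right hd1, numCross_union_right (by simpa using hxN)] at h3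
    have h5 : numCross G {a} {x} ≤ 1 := by
      rw [numCross_singleton_left]
      exact (card_filter_le _ _).trans (by simp)
    have h6 : numCross G {a} N = 0 := by
      have h7 := numEdges_erase_add (G := G) ha
      omega
    omega
  have hNsum : (∀ a ∈ N, 1 ≤ numCross G {a} K) → #N ≤ numCross G N K := by
    intro h
    rw [numCross_eq_sum]
    simpa using card_nsmul_le_sum N _ 1 h
  rcases Nat.lt_or_ge 3 #N with h4 | h3
  · -- For degree four, the only obstacle would be a single component joined to `N` by two edges,
    -- but the four vertices of `N` have an edge to it each.
    rcases hcomp K hK with ⟨k, hk, hke⟩ | ⟨hext, h⟩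
    · exact finishK k hk (by omega)
    · obtain ⟨Q, k, ht, -⟩ := hext.isTight
      have hke := ht.edges
      have hk := ht.canIsolate hK.2.1.1
      rcases (W \ K).eq_empty_or_nonempty with hW0 | hW0
      · rcases Nat.eq_zero_or_pos (numEdges G N) with hN0 | hN0
        · have := hNsum (hone_le hW0 hN0)
          omega
        · exact finishK k hk (by omega)
      · exact finishK1 hW0 k hk (by omega)
  have hN3 : #N = 3 := by omega
  have hR4 : #(insert x N) ≤ 4 := by rw [card_insert_of_notMem hxN]; omega
  rcases (W \ K).eq_empty_or_nonempty with hW0 | hW0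
  · -- For a single component, the count of edges falls short only if it is extremal with two or
    -- three edges to `N`, or a square with four.
    have hKW : K = W := subset_antisymm hK.1 (sdiff_eq_empty_iff_subset.1 hW0)
    have hSKN : S \ K = insert x N := by rw [hKW, hSW]
    have hKd : Disjoint K (insert x N) := hKW ▸ hWN
    have hKN : numCross G K (insert x N) = numCross G N K := by rw [← hSKN, hcross K hK]
    rw [hSKN] at hSK
    rcases hcomp K hK with ⟨k, hk, hke⟩ | ⟨hext, h⟩
    · rcases Nat.eq_zero_or_pos (numEdges G N) with hN0 | hN0
      swap
      · exact finishK k hk (by omega)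
      have h1 := hone_le hW0 hN0
      have h3' := hNsum h1
      by_cases hKsq : IsSquare G K
      · have h4' := hsq K hK hKsq
        have hkK := hKsq.numEdges_eq
        rcases eq_or_lt_of_le h4' with h5 | h5
        · obtain ⟨a, ha, hl⟩ := exists_not_hasLongCycle_of_square_claw
            (disjoint_of_subset_right (subset_insert x N) hKd) (fun a ha => ((hmN a).1 ha).2) hN3
            hN0 hKsq h5.symm h1
          rw [hSK] at hl
          exact hl (hone a ((hmN a).1 ha).1)
        · exact finishK 1 hKsq.canIsolate_one (by omega)
      · rcases ih K (hHS K hK) hK.2.1 hKsq with ⟨k', hk', hke'⟩ | hext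
        · exact finishK k' hk' (by omega)
        · obtain ⟨Q, k', ht, -⟩ := hext.isTight
          have hke' := ht.edges
          rcases eq_or_lt_of_le h3' with h5 | h5
          · refine hno ?_
            rw [← hSK]
            refine hasSlack_of_extremal_claw hKd hxN (fun a ha => ((hmN a).1 ha).2)
              (hxW0 K hK.1) hN3 hN0 hext ?_
            rw [numCross_eq_sum, card_eq_sum_ones] at h5
            exact fun a ha => (((sum_eq_sum_iff_of_le h1).1 h5) a ha).symm
          · exact finishK k' (ht.canIsolate hK.2.1.1) (by omega)
    · refine hno ?_
      rw [← hSK]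
      exact hasSlack_of_extremal_two hKd hext (hKN.trans h) hR4
  · -- Two components save enough unless both are extremal with two edges to `N`; more than two
    -- always do.
    obtain ⟨v, hv⟩ := hW0
    rcases hcomp K hK with ⟨k, hk, hke⟩ | ⟨hext, h⟩
    · exact finishK1 ⟨v, hv⟩ k hk (by omega)
    obtain ⟨Q, k, ht, -⟩ := hext.isTight
    have hke := ht.edges
    have hk := ht.canIsolate hK.2.1.1
    obtain ⟨K₂, hK₂', -⟩ := exists_isComponent_mem (G := G) hv
    have hK₂ := hK.of_sdiff hK₂'
    have hWK₂ := hsplit K₂ (W \ K) hK₂'.1 hK₂'.2.2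
    obtain ⟨l₂, hl₂, hle₂, hle₂1⟩ := canIsolate_of_components (G := G) (N := N) (M := ∅)
      (W := (W \ K) \ K₂) (fun H hH => hcomp1 H (hK.of_sdiff (hK₂'.of_sdiff hH)))
    rw [sdiff_empty] at hl₂
    have finish₂ : ∀ j, CanIsolate G K₂ j → CanIsolate G W (k + (j + l₂)) := fun j hj =>
      hglue K W hK.1 hK.2.2 _ _ hk (hglue K₂ _ hK₂'.1 hK₂'.2.2 _ _ hj hl₂)
    rcases hcomp K₂ hK₂ with ⟨j, hj, hje⟩ | ⟨hext₂, h'⟩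
    · exact finish _ (finish₂ j hj) (by omega)
    obtain ⟨Q₂, j, ht₂, -⟩ := hext₂.isTight
    have hje := ht₂.edges
    rcases ((W \ K) \ K₂).eq_empty_or_nonempty with hW₂ | hW₂
    swap
    · have := hle₂1 hW₂
      exact finish _ (finish₂ j (ht₂.canIsolate hK₂.2.1.1)) (by omega)
    have hWK₂' : W \ K = K₂ := subset_antisymm (sdiff_eq_empty_iff_subset.1 hW₂) hK₂'.1
    have hSKK : S \ K = K₂ ∪ insert x N := by
      rw [← hWK₂', ← hSW, union_comm, sdiff_union_sdiff_cancel hWS hK.1]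
    have hd₂ : Disjoint K₂ (insert x N) := disjoint_of_subset_left hK₂.1 hWN
    have hdK : Disjoint K (K₂ ∪ insert x N) := hSKK ▸ disjoint_sdiff
    refine hno ?_
    rw [← hSK, hSKK]
    refine hasSlack_of_extremal_two_two hdK hd₂ hext hext₂ ?_ ?_ hR4
    · rw [← hSKK, hcross K hK, h]
    · rw [numCross_comm, hRH K₂ hK₂.1, h']

/-- The bound, with its equality case, for connected vertex sets. -/
theorem hasSlack_or_isExtremal (hS : ConnectedOn G S) (hsq : ¬ IsSquare G S) :
    HasSlack G S ∨ IsExtremal G S := by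
  induction hn : #S using Nat.strong_induction_on generalizing S with
  | _ n ih =>
    subst hn
    have ih : ∀ H, H ⊂ S → ConnectedOn G H → ¬ IsSquare G H → HasSlack G H ∨ IsExtremal G H :=
      fun H hH hc hs => ih _ (card_lt_card hH) hc hs rfl
    by_cases hL : HasLongCycle G S
    swap
    · exact .inl ⟨0, canIsolate_of_not_hasLongCycle hL 0, by omega⟩
    have he : 5 ≤ numEdges G S := by
      by_contra hlt
      exact hsq (hS.isSquare hL (by omega))
    by_cases hcut : ∀ A ⊆ S, A.Nonempty → A ≠ S → 2 ≤ numCross G A (S \ A)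
    · exact hasSlack_or_isExtremal_of_bridgeless hS hL he hcut ih
    -- Facts about a bridge between `A` and `S \ A`.
    have hside : ∀ A ⊆ S, A.Nonempty → A ≠ S → (S \ A).Nonempty ∧ S \ A ≠ S := by
      intro A hA hne hAS
      refine ⟨sdiff_nonempty.2 fun h => hAS (subset_antisymm hA h), fun h => ?_⟩
      obtain ⟨a, ha⟩ := hne
      have := h ▸ hA ha
      simp [ha] at this
    have hbridge : ∀ A ⊆ S, A.Nonempty → A ≠ S → numCross G A (S \ A) ≤ 1 →
        numCross G A (S \ A) = 1 ∧ ConnectedOn G A ∧ ConnectedOn G (S \ A) := by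
      intro A hA hne hAS hx
      have := hS.2 A hA hne hAS
      refine ⟨by omega, hS.of_cut_one hA hne hx,
        hS.of_cut_one sdiff_subset (hside A hA hne hAS).1 ?_⟩
      rwa [Finset.sdiff_sdiff_eq_self hA, numCross_comm]
    have hssub : ∀ A ⊆ S, A ≠ S → A ⊂ S := fun A hA h => Finset.ssubset_iff_subset_ne.2 ⟨hA, h⟩
    by_cases hgood : ∃ A ⊆ S, A.Nonempty ∧ A ≠ S ∧ numCross G A (S \ A) ≤ 1 ∧ ¬ IsSquare G A ∧
        ¬ IsSquare G (S \ A)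
    · obtain ⟨A, hA, hne, hAS, hx, hq, hq'⟩ := hgood
      obtain ⟨hx1, hc, hc'⟩ := hbridge A hA hne hAS hx
      obtain ⟨hne', hAS'⟩ := hside A hA hne hAS
      have := hasSlack_or_isExtremal_of_bridge disjoint_sdiff hne hne' hx1
        (ih A (hssub A hA hAS) hc hq) (ih _ (hssub _ sdiff_subset hAS') hc' hq')
      rwa [union_sdiff_of_subset hA] at this
    -- Now every bridge has a square on one of its sides, and there is a bridge.
    obtain ⟨B, hB, hBS, hx, hBsq⟩ : ∃ B ⊆ S, B ≠ S ∧ numCross G B (S \ B) ≤ 1 ∧ IsSquare G B := by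
      push Not at hcut hgood
      obtain ⟨A, hA, hne, hAS, hx⟩ := hcut
      by_cases hq : IsSquare G A
      · exact ⟨A, hA, hAS, by omega, hq⟩
      · refine ⟨S \ A, sdiff_subset, (hside A hA hne hAS).2, ?_,
          hgood A hA hne hAS (by omega) hq⟩
        rw [Finset.sdiff_sdiff_eq_self hA, numCross_comm]
        omega
    have hBne : B.Nonempty := card_pos.1 (by rw [hBsq.card_eq]; omega)
    obtain ⟨hx1, -, hc⟩ := hbridge B hB hBne hBS hx
    rw [numCross_comm] at hx1
    obtain ⟨y, hy, w, hw, hyw⟩ := exists_adj_of_numCross_pos (by omega : 0 < numCross G (S \ B) B)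
    have := hasSlack_or_isExtremal_of_pendant_square sdiff_disjoint hc hBsq hx1 hy hw hyw (by
      intro H hH hHsq
      have hHS : H ⊆ S := hH.1.trans ((erase_subset _ _).trans sdiff_subset)
      have hyH : y ∉ H := fun h => notMem_erase y _ (hH.1 h)
      have hyS : y ∈ S := sdiff_subset hy
      have hHne : H ≠ S := by rintro rfl; exact hyH hyS
      refine ⟨?_, ih H (hssub H hHS hHne) hH.2.1 hHsq⟩
      -- The edges leaving `H` end in `y`; a single one would be a bridge without squares.
      have hHB : numCross G H (S \ H) ≤ numCross G {y} H := by
        have hcov : S \ H ⊆ {y} ∪ ((S \ B).erase y \ H ∪ B) := by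
          intro v hv
          simp only [mem_sdiff, mem_union, mem_singleton, mem_erase] at hv ⊢
          tauto
        have hHB : numCross G H B = 0 := by
          rw [numCross_eq_zero_iff]
          intro a ha b hb hab
          have := (eq_of_numCross_le_one hx1.le hy hw hyw (erase_subset _ _ (hH.1 ha)) hb hab).1
          exact hyH (this ▸ ha)
        refine (numCross_mono subset_rfl hcov).trans ?_
        have hdB : Disjoint ((S \ B).erase y \ H) B := disjoint_of_subset_left
          (sdiff_subset.trans (erase_subset _ _)) sdiff_disjoint
        have hdy : Disjoint {y} ((S \ B).erase y \ H ∪ B) := by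
          simp [(mem_sdiff.1 hy).2]
        rw [numCross_union_right hdy, numCross_union_right hdB, hH.2.2, hHB, numCross_comm]
        omega
      by_contra hlt
      refine hgood ⟨H, hHS, hH.2.1.1, hHne, by omega, hHsq, fun hsq' => ?_⟩
      have hsub : insert y B ⊆ S \ H := by
        intro v hv
        rcases mem_insert.1 hv with rfl | h
        · exact mem_sdiff.2 ⟨hyS, hyH⟩
        · refine mem_sdiff.2 ⟨hB h, fun hvH => ?_⟩
          have := hH.1 hvH
          simp [h] at this
      have := card_le_card hsub
      rw [hsq'.card_eq, card_insert_of_notMem (mem_sdiff.1 hy).2, hBsq.card_eq] at this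
      omega)
    rwa [sdiff_union_of_subset hB] at this

/-! ### Isolating sets and long cycles -/

/-- A cyclic sequence of `n + 4` adjacent vertices is a copy of a cycle. -/
def copyOfCycle {n : ℕ} {c : Fin (n + 4) → V} (hc : c.Injective)
    (ha : ∀ i, G.Adj (c i) (c (i + 1))) : (SimpleGraph.cycleGraph (n + 4)).Copy G where
  toHom := ⟨c, by
    intro i j hij
    rcases SimpleGraph.cycleGraph_adj.1 hij with h | h
    · obtain rfl := sub_eq_iff_eq_add.1 h
      rw [add_comm]
      exact (ha j).symm
    · obtain rfl := sub_eq_iff_eq_add.1 h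
      rw [add_comm]
      exact ha i⟩
  injective' := hc

lemma isIsolatingSet_iff [Fintype V] :
    IsIsolatingSet nonTriangleCycles G (D : Set V) ↔ ¬ HasLongCycle G (residual G univ D) := by
  have hres : ∀ x, x ∈ residual G univ D ↔ x ∉ closedNbhd G (D : Set V) := by
    intro x
    simp [mem_residual, closedNbhd]
  constructor
  · rintro h ⟨n, c, hc, ha, hm⟩
    obtain ⟨x, hx, hxH⟩ := h (copyOfCycle hc ha).toSubgraph
      ⟨_, ⟨n + 4, by omega, rfl⟩, ⟨(copyOfCycle hc ha).isoToSubgraph⟩⟩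
    simp only [SimpleGraph.Subgraph.map_verts, SimpleGraph.Subgraph.verts_top,
      Set.image_univ] at hxH
    obtain ⟨i, rfl⟩ := hxH
    exact (hres _).1 (hm i) hx
  · rintro h H ⟨F, ⟨n, hn, rfl⟩, ⟨f⟩⟩
    obtain ⟨n, rfl⟩ := Nat.exists_eq_add_of_le' hn
    by_contra hcon
    refine h ⟨n, fun i => f i, fun i j hij => f.injective (Subtype.ext hij), fun i => ?_,
      fun i => ?_⟩
    · have h1 : (SimpleGraph.cycleGraph (n + 4)).Adj i (i + 1) := by
        rw [SimpleGraph.cycleGraph_adj]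
        exact .inr (by simp)
      exact H.coe_adj_sub _ _ (f.map_adj_iff.2 h1)
    · rw [hres]
      exact fun h => hcon ⟨f i, h, (f i).2⟩

lemma isolationNumber_le [Fintype V] {k : ℕ} (h : CanIsolate G univ k) :
    isolationNumber nonTriangleCycles G ≤ k := by
  obtain ⟨D, hD, hl⟩ := h
  refine le_trans (Nat.sInf_le ?_) hD
  exact ⟨D, rfl, isIsolatingSet_iff.2 hl⟩

lemma exists_card_eq_isolationNumber [Fintype V] : ∃ D : Finset V,
    #D = isolationNumber nonTriangleCycles G ∧
      IsIsolatingSet nonTriangleCycles G (D : Set V) := by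
  refine Nat.sInf_mem (s := {k : ℕ | ∃ D : Finset V, #D = k ∧
    IsIsolatingSet nonTriangleCycles G (D : Set V)}) ⟨_, univ, rfl, ?_⟩
  rw [isIsolatingSet_iff]
  intro h
  have := h.four_le_card
  have h0 : residual G univ (univ : Finset V) = ∅ := by
    ext x
    simp [mem_residual]
  simp [h0] at this

lemma isolationNumber_pos [Fintype V] (h : HasLongCycle G univ) :
    0 < isolationNumber nonTriangleCycles G := by
  obtain ⟨D, hD, hl⟩ := exists_card_eq_isolationNumber (G := G)
  rw [← hD, card_pos, nonempty_iff_ne_empty]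
  rintro rfl
  rw [isIsolatingSet_iff] at hl
  refine hl (h.mono fun x _ => ?_)
  simp [mem_residual]

lemma coe_filter_sym2 (S : Finset V) : (({e ∈ S.sym2 | e ∈ G.edgeSet} : Finset (Sym2 V)) : Set _) =
    {e | (∀ v ∈ e, v ∈ S) ∧ e ∈ G.edgeSet} := by
  ext e
  simp [mem_sym2_iff]

lemma numEdges_univ [Fintype V] : numEdges G univ = G.edgeSet.ncard := by
  rw [numEdges, ← Set.ncard_coe_finset, coe_filter_sym2]
  simp

/-- The image of a connected graph under a homomorphism is connected. -/
lemma connectedOn_of_connected {U : Type*} {L : SimpleGraph U} (hL : L.Connected) (f : U → V)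
    (hf : ∀ a b, L.Adj a b → G.Adj (f a) (f b)) (hS : ∀ v, v ∈ S ↔ ∃ u, f u = v) :
    ConnectedOn G S := by
  refine ⟨hL.nonempty.elim fun u => ⟨f u, (hS _).2 ⟨u, rfl⟩⟩, fun A hA hne hAS => ?_⟩
  obtain ⟨a, ha⟩ := hne
  obtain ⟨b, hbS, hbA⟩ := not_subset.1 fun h => hAS (subset_antisymm hA h)
  obtain ⟨a, rfl⟩ := (hS a).1 (hA ha)
  obtain ⟨b, rfl⟩ := (hS b).1 hbS
  obtain ⟨p⟩ := hL.preconnected a b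
  obtain ⟨d, -, hd1, hd2⟩ := p.exists_boundary_dart {u | f u ∈ A} ha hbA
  exact numCross_pos hd1 (mem_sdiff.2 ⟨(hS _).2 ⟨_, rfl⟩, hd2⟩) (hf _ _ d.adj)

/-! ### The small extremal graphs -/

/-- In a connected set, a part that contains all edges is everything. -/
lemma ConnectedOn.eq_of_numEdges_le (hS : ConnectedOn G S) (hT : T ⊆ S) (hne : T.Nonempty)
    (h : numEdges G S ≤ numEdges G T) : T = S := by
  by_contra hTS
  have := hS.2 T hT hne hTS
  have := numEdges_add_sdiff (G := G) hT
  omega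

/-- A cycle that uses all edges of a connected graph is the whole graph. -/
lemma nonempty_iso_cycleGraph [Fintype V] (hG : ConnectedOn G univ) {n : ℕ}
    {c : Fin (n + 4) → V} (hc : c.Injective) (ha : ∀ i, G.Adj (c i) (c (i + 1)))
    (he : numEdges G univ = n + 4) : Nonempty (SimpleGraph.cycleGraph (n + 4) ≃g G) := by
  have hsurj : c.Surjective := by
    have := hG.eq_of_numEdges_le (T := univ.image c) (subset_univ _) (by simp)
      (he.le.trans (length_le_numEdges hc ha (by simp)))
    intro v
    have hv : v ∈ univ.image c := this ▸ mem_univ v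
    simpa using hv
  have hE : univ.image (fun i => s(c i, c (i + 1))) =
      ({e ∈ (univ : Finset V).sym2 | e ∈ G.edgeSet} : Finset (Sym2 V)) := by
    refine eq_of_subset_of_card_le ?_ ?_
    · intro e h
      obtain ⟨i, -, rfl⟩ := mem_image.1 h
      simp [ha]
    · rw [card_image_of_injective _ (cycle_edges_injective hc), card_univ, Fintype.card_fin]
      exact he.le
  refine ⟨⟨Equiv.ofBijective c ⟨hc, hsurj⟩, fun {i j} => ⟨fun h => ?_, fun h => ?_⟩⟩⟩
  · have h' : G.Adj (c i) (c j) := h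
    have hm : s(c i, c j) ∈ ({e ∈ (univ : Finset V).sym2 | e ∈ G.edgeSet} : Finset (Sym2 V)) := by
      simp [h']
    rw [← hE] at hm
    obtain ⟨k, -, hk⟩ := mem_image.1 hm
    rw [SimpleGraph.cycleGraph_adj]
    simp only [Sym2.eq_iff] at hk
    rcases hk with ⟨h1, h2⟩ | ⟨h1, h2⟩
    · rw [← hc h1, ← hc h2]
      exact .inr (by simp)
    · rw [← hc h1, ← hc h2]
      exact .inl (by simp)
  · exact (copyOfCycle hc ha).toHom.map_adj h

lemma IsSquare.exists_fun (h : IsSquare G S) : ∃ c : Fin 4 → V, c.Injective ∧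
    (∀ v, v ∈ S ↔ ∃ i, c i = v) ∧
    ∀ i j, G.Adj (c i) (c j) ↔ (SimpleGraph.cycleGraph 4).Adj i j := by
  obtain ⟨a, b, c, d, rfl, hac, hbd, h1, h2, h3, h4, h5, h6⟩ := h
  have n1 := h1.ne
  have n2 := h2.ne
  have n3 := h3.ne
  have n4 := h4.ne
  have h5' : ¬ G.Adj c a := fun h => h5 h.symm
  have h6' : ¬ G.Adj d b := fun h => h6 h.symm
  refine ⟨![a, b, c, d], ?_, ?_, ?_⟩
  · intro i j hij
    fin_cases i <;> fin_cases j <;> simp_all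
  · intro v
    simp [Fin.exists_fin_succ, eq_comm]
  · intro i j
    fin_cases i <;> fin_cases j <;>
      simp [SimpleGraph.cycleGraph_adj, h1, h2, h3, h4, h5, h6, h5', h6', h1.symm, h2.symm, h3.symm,
        h4.symm] <;> decide

lemma IsSquare.nonempty_iso [Fintype V] (h : IsSquare G univ) :
    Nonempty (SimpleGraph.cycleGraph 4 ≃g G) := by
  obtain ⟨c, hc, hS, ha⟩ := h.exists_fun
  exact ⟨⟨Equiv.ofBijective c ⟨hc, fun v => (hS v).1 (mem_univ v)⟩, fun {i j} => ha i j⟩⟩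

lemma nonempty_iso_diamond {c : Fin 4 → V} (hc : c.Bijective)
    (ha : ∀ i, G.Adj (c i) (c (i + 1))) (h02 : G.Adj (c 0) (c 2)) (h13 : ¬ G.Adj (c 1) (c 3)) :
    Nonempty (diamond ≃g G) := by
  have h1 : G.Adj (c 0) (c 1) := ha 0
  have h2 : G.Adj (c 1) (c 2) := ha 1
  have h3 : G.Adj (c 2) (c 3) := ha 2
  have h4 : G.Adj (c 3) (c 0) := ha 3
  have h13' : ¬ G.Adj (c 3) (c 1) := fun h => h13 h.symm
  refine ⟨⟨Equiv.ofBijective c hc, fun {i j} => ?_⟩⟩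
  change G.Adj (c i) (c j) ↔ diamond.Adj i j
  fin_cases i <;> fin_cases j <;>
    simp [diamond, SimpleGraph.edge_adj, SimpleGraph.cycleGraph_adj, h1, h2, h3, h4, h02, h13, h13',
      h1.symm, h2.symm, h3.symm, h4.symm, h02.symm] <;> decide

lemma IsSmallExtremal.nonempty_iso [Fintype V] (hG : ConnectedOn G univ)
    (hL : HasLongCycle G univ) (h : IsSmallExtremal G univ) :
    Nonempty (diamond ≃g G) ∨ Nonempty (SimpleGraph.cycleGraph 5 ≃g G) := by
  obtain ⟨n, c, hc, ha, hm⟩ := hL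
  have hn := length_le_numEdges hc ha hm
  rw [h.1] at hn
  obtain rfl | rfl : n = 1 ∨ n = 0 := by omega
  · exact .inr (nonempty_iso_cycleGraph hG hc ha h.1)
  left
  have h01 : G.Adj (c 0) (c 1) := ha 0
  have h12 : G.Adj (c 1) (c 2) := ha 1
  have h23 : G.Adj (c 2) (c 3) := ha 2
  have h30 : G.Adj (c 3) (c 0) := ha 3
  have h02 : c 0 ≠ c 2 := hc.ne (by decide)
  have h13 : c 1 ≠ c 3 := hc.ne (by decide)
  have hq := numEdges_quadrilateral h02 h13 h01 h12 h23 h30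
  -- A further vertex would need two of the five edges.
  have hT : ({c 0, c 1, c 2, c 3} : Finset V) = univ := by
    rw [eq_univ_iff_forall]
    intro v
    by_contra hv
    have h1 := numEdges_erase_add (G := G) (mem_univ v)
    have h2 := h.2 v (mem_univ v)
    have h3 : numEdges G {c 0, c 1, c 2, c 3} ≤ numEdges G (univ.erase v) :=
      numEdges_mono fun x hx => mem_erase.2 ⟨by rintro rfl; exact hv hx, mem_univ x⟩
    have := h.1
    omega
  have hbij : c.Bijective := by
    refine ⟨hc, fun v => ?_⟩
    have hv : v ∈ ({c 0, c 1, c 2, c 3} : Finset V) := hT ▸ mem_univ v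
    simp only [mem_insert, mem_singleton] at hv
    rcases hv with rfl | rfl | rfl | rfl <;> exact ⟨_, rfl⟩
  rw [hT, h.1] at hq
  by_cases h' : G.Adj (c 0) (c 2)
  · refine nonempty_iso_diamond hbij ha h' fun h'' => ?_
    simp [h', h''] at hq
  · have h'' : G.Adj (c 1) (c 3) := by
      by_contra h''
      simp [h', h''] at hq
    refine nonempty_iso_diamond (c := fun i => c (i + 1))
      (hbij.comp (Equiv.addRight (1 : Fin 4)).bijective) (fun i => ha (i + 1)) h'' ?_
    exact fun h3 => h' (by simpa using h3.symm)

lemma HasLongCycle.of_iso [Fintype V] {n : ℕ} {L : SimpleGraph (Fin (n + 4))}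
    (hL : SimpleGraph.cycleGraph (n + 4) ≤ L) (f : L ≃g G) : HasLongCycle G univ := by
  refine ⟨n, f, f.injective, fun i => f.map_adj_iff.2 (hL ?_), by simp⟩
  rw [SimpleGraph.cycleGraph_adj]
  exact .inr (by simp)

lemma ncard_edgeSet_diamond : diamond.edgeSet.ncard = 5 := by
  classical
  have h01 : diamond.Adj 0 1 := .inl (by decide)
  have h12 : diamond.Adj 1 2 := .inl (by decide)
  have h23 : diamond.Adj 2 3 := .inl (by decide)
  have h30 : diamond.Adj 3 0 := .inl (by decide)
  have h02 : diamond.Adj 0 2 := .inr (by simp [SimpleGraph.edge_adj])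
  have h13 : ¬ diamond.Adj 1 3 := by
    rintro (h | h)
    · revert h
      decide
    · simp [SimpleGraph.edge_adj] at h
  rw [← numEdges_univ, show (univ : Finset (Fin 4)) = {0, 1, 2, 3} by decide,
    numEdges_quadrilateral (by decide) (by decide) h01 h12 h23 h30, if_pos h02, if_neg h13]

lemma ncard_edgeSet_cycleGraph_four : (SimpleGraph.cycleGraph 4).edgeSet.ncard = 4 := by
  rw [← SimpleGraph.coe_edgeFinset, Set.ncard_coe_finset]
  decide

lemma ncard_edgeSet_cycleGraph_five : (SimpleGraph.cycleGraph 5).edgeSet.ncard = 5 := by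
  rw [← SimpleGraph.coe_edgeFinset, Set.ncard_coe_finset]
  decide

lemma ncard_edgeSet_congr {U : Type*} {L : SimpleGraph U} (f : L ≃g G) :
    L.edgeSet.ncard = G.edgeSet.ncard :=
  Nat.card_congr f.mapEdgeSet

/-! ### The isolation number of a special graph -/

namespace SpecialStructure

lemma adj_cases {m : ℕ} (Z : SpecialStructure m (SimpleGraph.cycleGraph 4) G) {x y : V}
    (h : G.Adj x y) : (x ∈ Set.range Z.v ∧ y ∈ Set.range Z.v) ∨ Z.T'.Adj x y ∨
      ∃ i, (Z.copyF i).Adj x y ∨ (x = Z.v i ∧ y = Z.w i) ∨ (x = Z.w i ∧ y = Z.v i) := by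
  have h1 : (⊤ : G.Subgraph).Adj x y := h
  rw [Z.cover] at h1
  simp only [SimpleGraph.Subgraph.sup_adj, SimpleGraph.Subgraph.iSup_adj] at h1
  rcases h1 with (h1 | h1) | ⟨i, h1⟩
  · rw [← Z.T_verts]
    exact .inl ⟨h1.fst_mem, h1.snd_mem⟩
  · exact .inr (.inl h1)
  · rw [Z.constituent_eq] at h1
    simp only [SimpleGraph.Subgraph.sup_adj, SimpleGraph.subgraphOfAdj_adj, Sym2.eq_iff] at h1
    refine .inr (.inr ⟨i, ?_⟩)
    rcases h1 with h1 | ⟨h1, h2⟩ | ⟨h1, h2⟩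
    · exact .inl h1
    · exact .inr (.inl ⟨h1.symm, h2.symm⟩)
    · exact .inr (.inr ⟨h2.symm, h1.symm⟩)

lemma mem_constituent {m : ℕ} (Z : SpecialStructure m (SimpleGraph.cycleGraph 4) G) {x : V}
    {i : Fin Z.q} : x ∈ (Z.constituent i).verts ↔ x ∈ (Z.copyF i).verts ∨ x = Z.v i := by
  rw [Z.constituent_eq]
  simp only [SimpleGraph.Subgraph.verts_sup, SimpleGraph.subgraphOfAdj_verts, Set.mem_union,
    Set.mem_insert_iff, Set.mem_singleton_iff]
  have := Z.w_mem i
  constructor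
  · rintro (h | h | rfl)
    exacts [.inl h, .inr h, .inl this]
  · rintro (h | h)
    exacts [.inl h, .inr (.inl h)]

lemma eq_of_mem_copyF {m : ℕ} (Z : SpecialStructure m (SimpleGraph.cycleGraph 4) G) {x : V}
    {i j : Fin Z.q} (hi : x ∈ (Z.copyF i).verts) (hj : x ∈ (Z.copyF j).verts) : i = j := by
  by_contra h
  exact Set.disjoint_left.1 (Z.copyF_disjoint i j h) hi hj

lemma eq_v_of_mem_T' {m : ℕ} (Z : SpecialStructure m (SimpleGraph.cycleGraph 4) G) {x : V}
    {i : Fin Z.q} (hx : x ∈ Z.T'.verts) (hi : x ∈ (Z.constituent i).verts) :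
    x ∈ Set.range Z.v := by
  have h1 : x ∈ Z.T'.verts ∩ ⋃ i, (Z.constituent i).verts := ⟨hx, Set.mem_iUnion.2 ⟨i, hi⟩⟩
  rw [Z.T'_inter i.pos] at h1
  rw [h1]
  exact ⟨_, rfl⟩

/-- The neighbours of a vertex of `Fᵢ` lie in the constituent `Gᵢ`. -/
lemma mem_constituent_of_adj {m : ℕ} (Z : SpecialStructure m (SimpleGraph.cycleGraph 4) G)
    {x y : V} {i : Fin Z.q} (hx : x ∈ (Z.copyF i).verts) (h : G.Adj x y) :
    y ∈ (Z.copyF i).verts ∨ y = Z.v i := by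
  have hxv : ∀ j, x ≠ Z.v j := fun j hj => Z.v_notMem j i (hj ▸ hx)
  rcases Z.adj_cases h with ⟨⟨j, h1⟩, -⟩ | h1 | ⟨j, h1 | ⟨h1, -⟩ | ⟨h1, h2⟩⟩
  · exact absurd h1.symm (hxv j)
  · obtain ⟨j, hj⟩ := Z.eq_v_of_mem_T' h1.fst_mem (Z.mem_constituent.2 (.inl hx))
    exact absurd hj.symm (hxv j)
  · obtain rfl := Z.eq_of_mem_copyF hx h1.fst_mem
    exact .inl h1.snd_mem
  · exact absurd h1 (hxv j)
  · obtain rfl := Z.eq_of_mem_copyF hx (h1 ▸ Z.w_mem j)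
    exact .inr h2

lemma ncard_copyF {m : ℕ} (Z : SpecialStructure m (SimpleGraph.cycleGraph 4) G) (i : Fin Z.q) :
    (Z.copyF i).verts.ncard = 4 := by
  obtain ⟨f⟩ := Z.isCopy i
  have := Nat.card_congr f.toEquiv
  rw [Nat.card_eq_fintype_card, Fintype.card_fin] at this
  exact this.symm

/-- An isolating set meets every constituent, because the closed neighbourhood of `Fᵢ` is contained
in the constituent. -/
lemma q_le_card {m : ℕ} (Z : SpecialStructure m (SimpleGraph.cycleGraph 4) G)
    (hD : IsIsolatingSet nonTriangleCycles G (D : Set V)) : Z.q ≤ #D := by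
  have h1 : ∀ i, ∃ d ∈ D, d ∈ (Z.copyF i).verts ∨ d = Z.v i := by
    intro i
    obtain ⟨x, hx, hxF⟩ := hD (Z.copyF i) ⟨_, ⟨4, le_rfl, rfl⟩, Z.isCopy i⟩
    rcases hx with hx | ⟨d, hd, hdx⟩
    · exact ⟨x, hx, .inl hxF⟩
    · exact ⟨d, hd, Z.mem_constituent_of_adj hxF hdx.symm⟩
  choose g hgD hg using h1
  have hinj : Function.Injective g := by
    intro i j hij
    rcases hg i with hi | hi <;> rcases hg j with hj | hj
    · exact Z.eq_of_mem_copyF hi (hij ▸ hj)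
    · exact absurd (hj ▸ hij ▸ hi) (Z.v_notMem j i)
    · exact absurd (hi ▸ hij ▸ hj) (Z.v_notMem i j)
    · exact Z.v_injective (hi.symm.trans (hij.trans hj))
  have := card_le_card_of_injOn (s := univ) (t := D) g (fun i _ => hgD i) hinj.injOn
  simpa using this

/-- The connections `v₁, …, v_q` isolate a special graph. A long cycle that they do not meet
could not enter a constituent, and a long cycle in the remainder graph together with a path of
length at least two to `v_q` would need six edges. -/
lemma not_hasLongCycle [Fintype V] {m : ℕ}
    (Z : SpecialStructure m (SimpleGraph.cycleGraph 4) G) (hm : numEdges G univ = m)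
    (hG : ConnectedOn G univ) (hsq : ¬ IsSquare G univ) :
    ¬ HasLongCycle G (residual G univ (univ.image Z.v)) := by
  have hdiv := Z.division
  have hr := Z.r_le
  rw [ncard_edgeSet_cycleGraph_four] at hdiv hr
  intro hL
  rcases Nat.eq_zero_or_pos Z.q with hq | hq
  · refine hsq (hG.isSquare (hL.mono (subset_univ _)) ?_)
    rw [hq] at hdiv
    omega
  obtain ⟨n, c, hc, ha, hm⟩ := hL
  have hcv : ∀ i j, c i ≠ Z.v j := fun i j h =>
    (mem_residual.1 (hm i)).2.1 (mem_image.2 ⟨j, mem_univ _, h.symm⟩)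
  have hcadj : ∀ i j, ¬ G.Adj (Z.v j) (c i) := fun i j =>
    (mem_residual.1 (hm i)).2.2 _ (mem_image_of_mem _ (mem_univ j))
  by_cases hF : ∃ j i, c i ∈ (Z.copyF j).verts
  · obtain ⟨j, i, hi⟩ := hF
    have hall : ∀ k, c k ∈ (Z.copyF j).verts := fin_forall_of_succ
      (p := fun k => c k ∈ (Z.copyF j).verts)
      (fun k hk => (Z.mem_constituent_of_adj hk (ha k)).resolve_right (hcv _ _)) hi
    -- The vertex `w_j` is dominated, so only three vertices of the copy remain.
    have hw : ∀ k, c k ≠ Z.w j := fun k hk => hcadj k j (hk ▸ Z.adj_v_w j)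
    have hfin : (Z.copyF j).verts.Finite := Set.toFinite _
    have h1 : Set.range c ⊆ (Z.copyF j).verts \ {Z.w j} := by
      rintro _ ⟨k, rfl⟩
      exact ⟨hall k, hw k⟩
    have h2 := Set.ncard_le_ncard h1
    rw [Set.ncard_sdiff_singleton_of_mem (Z.w_mem j), Z.ncard_copyF, ← Set.image_univ,
      Set.ncard_image_of_injective _ hc, Set.ncard_univ, Nat.card_eq_fintype_card,
      Fintype.card_fin] at h2
    omega
  push Not at hF
  have hT' : ∀ i, Z.T'.Adj (c i) (c (i + 1)) := by
    intro i
    rcases Z.adj_cases (ha i) with ⟨⟨j, h1⟩, -⟩ | h1 | ⟨j, h1 | ⟨h1, -⟩ | ⟨-, h1⟩⟩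
    · exact absurd h1.symm (hcv i j)
    · exact h1
    · exact absurd h1.fst_mem (hF j i)
    · exact absurd h1 (hcv i j)
    · exact absurd h1 (hcv _ j)
  classical
  obtain ⟨L, hLdef⟩ : ∃ L, L = Z.T'.spanningCoe := ⟨_, rfl⟩
  have hLadj : ∀ x y, L.Adj x y ↔ Z.T'.Adj x y := by simp [hLdef]
  obtain ⟨Y, hY⟩ : ∃ Y : Finset V, Y = Z.T'.verts.toFinset := ⟨_, rfl⟩
  have hmY : ∀ x, x ∈ Y ↔ x ∈ Z.T'.verts := by simp [hY]
  have hconn : ConnectedOn L Y := connectedOn_of_connected Z.T'_connected Subtype.val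
    (fun a b h => (hLadj _ _).2 h) (fun v => by simp [hmY])
  have hLe : numEdges L Y ≤ 5 := by
    have h1 : numEdges L Y ≤ numEdges L univ := numEdges_mono (subset_univ _)
    have h2 : L.edgeSet.ncard = Z.r := by
      rw [hLdef, SimpleGraph.Subgraph.edgeSet_spanningCoe, Z.T'_edges_pos hq]
    rw [numEdges_univ] at h1
    omega
  obtain ⟨u, hu⟩ : ∃ u, u = Z.v ⟨Z.q - 1, Nat.sub_lt hq Nat.one_pos⟩ := ⟨_, rfl⟩
  have huY : u ∈ Y := by
    have : u ∈ Z.T'.verts ∩ ⋃ i, (Z.constituent i).verts := by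
      rw [Z.T'_inter hq, hu]
      rfl
    exact (hmY u).2 this.1
  obtain ⟨X, hX⟩ : ∃ X : Finset V, X = univ.image c := ⟨_, rfl⟩
  have hmX : ∀ i, c i ∈ X := by simp [hX]
  have hXY : X ⊆ Y.erase u := by
    intro x hx
    rw [hX] at hx
    obtain ⟨i, -, rfl⟩ := mem_image.1 hx
    exact mem_erase.2 ⟨hu ▸ hcv i _, (hmY _).2 (hT' i).fst_mem⟩
  have hXu : u ∉ X := fun h => notMem_erase _ _ (hXY h)
  have hXe : n + 4 ≤ numEdges L X :=
    length_le_numEdges hc (fun i => (hLadj _ _).2 (hT' i)) hmX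
  -- One edge leaves the cycle, and it does not end in `u`; one edge starts in `u`.
  have h1 : 0 < numCross L X (Y.erase u \ X) := by
    obtain ⟨a, haX, b, hb, hab⟩ := exists_adj_of_numCross_pos
      (hconn.2 X (hXY.trans (erase_subset _ _)) ⟨c 0, hmX 0⟩ (by rintro rfl; exact hXu huY))
    refine numCross_pos haX (mem_sdiff.2 ⟨mem_erase.2 ⟨?_, (mem_sdiff.1 hb).1⟩,
      (mem_sdiff.1 hb).2⟩) hab
    rintro rfl
    rw [hX] at haX
    obtain ⟨i, -, rfl⟩ := mem_image.1 haX
    exact hcadj i _ (hu ▸ ((hLadj _ _).1 hab).adj_sub.symm)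
  have h2 : 0 < numCross L {u} Y := by
    refine (hconn.2 {u} (by simpa using huY) (by simp) ?_).trans_le
      (numCross_mono subset_rfl sdiff_subset)
    intro h
    have := hXY (hmX 0)
    simp [← h] at this
  have h3 := numEdges_add_sdiff (G := L) hXY
  have h4 := numEdges_erase_add (G := L) huY
  omega

lemma isolationNumber_eq [Fintype V] {m : ℕ}
    (Z : SpecialStructure m (SimpleGraph.cycleGraph 4) G) (hm : numEdges G univ = m)
    (hG : ConnectedOn G univ) (hsq : ¬ IsSquare G univ) :
    isolationNumber nonTriangleCycles G = Z.q := by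
  refine le_antisymm (isolationNumber_le ⟨univ.image Z.v, card_image_le.trans (by simp),
    Z.not_hasLongCycle hm hG hsq⟩) ?_
  obtain ⟨D, hD, hl⟩ := exists_card_eq_isolationNumber (G := G)
  rw [← hD]
  exact Z.q_le_card hl

end SpecialStructure

/-! ### Constituent trees are pure special graphs -/

variable (G) in
/-- A global description of constituent trees: `f` maps each vertex of `S` to the connection of its
constituent, so that the constituents are the fibres of `f`. -/
structure IsConstituentMap (S Q : Finset V) (f : V → V) : Prop where
  subset : Q ⊆ S
  map_mem : ∀ x ∈ S, f x ∈ Q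
  map_eq : ∀ v ∈ Q, f v = v
  adj : ∀ x ∈ S, ∀ y ∈ S, G.Adj x y → f x = f y ∨ (x ∈ Q ∧ y ∈ Q)
  isSquare : ∀ v ∈ Q, IsSquare G {x ∈ S | f x = v ∧ x ≠ v}
  numCross_eq : ∀ v ∈ Q, numCross G {v} {x ∈ S | f x = v ∧ x ≠ v} = 1
  connectedOn : ConnectedOn G Q
  numEdges_quotient : numEdges G Q + 1 = #Q
  numEdges_eq : numEdges G S + 1 = 6 * #Q

lemma ConnectedOn.union (hA : ConnectedOn G A) (hB : ConnectedOn G B)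
    (h : 0 < numCross G A B) : ConnectedOn G (A ∪ B) := by
  refine ⟨hA.1.mono subset_union_left, fun X hX hne hXAB => ?_⟩
  by_contra hcon
  have h0 : ∀ a ∈ X, ∀ b ∈ (A ∪ B) \ X, ¬ G.Adj a b :=
    numCross_eq_zero_iff.1 (by omega)
  -- Each of the two sets lies on one side of the cut.
  have key : ∀ C ⊆ A ∪ B, ConnectedOn G C → C ⊆ X ∨ Disjoint C X := by
    intro C hC hCc
    by_contra hno
    rw [not_or, not_disjoint_iff] at hno
    obtain ⟨h1, u, huC, huX⟩ := hno
    obtain ⟨a, ha, b, hb, hab⟩ := exists_adj_of_numCross_pos (hCc.2 (C ∩ X) inter_subset_left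
      ⟨u, mem_inter.2 ⟨huC, huX⟩⟩ (fun h => h1 (inter_eq_left.1 h)))
    simp only [mem_sdiff, mem_inter, not_and] at ha hb
    exact h0 a ha.2 b (mem_sdiff.2 ⟨hC hb.1, hb.2 hb.1⟩) hab
  obtain ⟨a, ha, b, hb, hab⟩ := exists_adj_of_numCross_pos h
  rcases key A subset_union_left hA with h1 | h1 <;> rcases key B subset_union_right hB with h2 | h2
  · exact hXAB (subset_antisymm hX (union_subset h1 h2))
  · exact h0 a (h1 ha) b (mem_sdiff.2 ⟨mem_union_right _ hb, disjoint_left.1 h2 hb⟩) hab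
  · exact h0 b (h2 hb) a (mem_sdiff.2 ⟨mem_union_left _ ha, disjoint_left.1 h1 ha⟩) hab.symm
  · obtain ⟨x, hx⟩ := hne
    rcases mem_union.1 (hX hx) with h | h
    · exact disjoint_left.1 h1 h hx
    · exact disjoint_left.1 h2 h hx

lemma connectedOn_singleton (v : V) : ConnectedOn G {v} := by
  refine ⟨by simp, fun A hA hne h => ?_⟩
  rcases subset_singleton_iff.1 hA with rfl | rfl
  · simp at hne
  · exact absurd rfl h

lemma IsConstituentTree.exists_map (h : IsConstituentTree G S Q) :
    ∃ f, IsConstituentMap G S Q f := by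
  induction h with
  | @single K y hK hy hx =>
    have hfib : {x ∈ insert y K | y = y ∧ x ≠ y} = K := by
      ext x
      simp only [mem_filter, mem_insert, true_and]
      constructor
      · rintro ⟨h | h, h'⟩
        exacts [absurd h h', h]
      · exact fun h => ⟨.inr h, by rintro rfl; exact hy h⟩
    refine ⟨fun _ => y, by simp, by simp, by simp, by simp, ?_, ?_, connectedOn_singleton y,
      by simp, ?_⟩
    · intro v hv
      obtain rfl := mem_singleton.1 hv
      rwa [hfib]
    · intro v hv
      obtain rfl := mem_singleton.1 hv
      rwa [hfib]
    · rw [numEdges_insert hy, hK.numEdges_eq, hx, card_singleton]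
  | @join S₁ S₂ Q₁ Q₂ _ _ hd hS hQ ih₁ ih₂ =>
    obtain ⟨f₁, h₁⟩ := ih₁
    obtain ⟨f₂, h₂⟩ := ih₂
    have hdQ : Disjoint Q₁ Q₂ := disjoint_of_subset_left h₁.subset
      (disjoint_of_subset_right h₂.subset hd)
    have hn : ∀ x ∈ S₂, x ∉ S₁ := fun x hx => disjoint_right.1 hd hx
    obtain ⟨f, hf⟩ : ∃ f : V → V, f = fun x => if x ∈ S₁ then f₁ x else f₂ x := ⟨_, rfl⟩
    have hf₁ : ∀ x ∈ S₁, f x = f₁ x := fun x hx => by simp [hf, hx]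
    have hf₂ : ∀ x ∈ S₂, f x = f₂ x := fun x hx => by simp [hf, hn x hx]
    have hfib₁ : ∀ v ∈ Q₁, {x ∈ S₁ ∪ S₂ | f x = v ∧ x ≠ v} = {x ∈ S₁ | f₁ x = v ∧ x ≠ v} := by
      intro v hv
      ext x
      simp only [mem_filter, mem_union]
      constructor
      · rintro ⟨hx | hx, h1, h2⟩
        · exact ⟨hx, hf₁ x hx ▸ h1, h2⟩
        · rw [hf₂ x hx] at h1
          exact absurd (h1 ▸ h₂.map_mem x hx) (disjoint_left.1 hdQ hv)
      · rintro ⟨hx, h1, h2⟩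
        exact ⟨.inl hx, (hf₁ x hx).trans h1, h2⟩
    have hfib₂ : ∀ v ∈ Q₂, {x ∈ S₁ ∪ S₂ | f x = v ∧ x ≠ v} = {x ∈ S₂ | f₂ x = v ∧ x ≠ v} := by
      intro v hv
      ext x
      simp only [mem_filter, mem_union]
      constructor
      · rintro ⟨hx | hx, h1, h2⟩
        · rw [hf₁ x hx] at h1
          exact absurd hv (disjoint_left.1 hdQ (h1 ▸ h₁.map_mem x hx))
        · exact ⟨hx, hf₂ x hx ▸ h1, h2⟩
      · rintro ⟨hx, h1, h2⟩
        exact ⟨.inr hx, (hf₂ x hx).trans h1, h2⟩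
    -- The only edge between the two parts joins connections.
    have hbridge : ∀ x ∈ S₁, ∀ y ∈ S₂, G.Adj x y → x ∈ Q₁ ∧ y ∈ Q₂ := by
      intro x hx y hy hxy
      obtain ⟨a, ha, b, hb, hab⟩ := exists_adj_of_numCross_pos (by omega : 0 < numCross G Q₁ Q₂)
      obtain ⟨rfl, rfl⟩ :=
        eq_of_numCross_le_one hS.le (h₁.subset ha) (h₂.subset hb) hab hx hy hxy
      exact ⟨ha, hb⟩
    refine ⟨f, union_subset_union h₁.subset h₂.subset, fun x hx => ?_, fun v hv => ?_,
      fun x hx y hy hxy => ?_, fun v hv => ?_, fun v hv => ?_,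
      h₁.connectedOn.union h₂.connectedOn (by omega), ?_, ?_⟩
    · rcases mem_union.1 hx with hx | hx
      · rw [hf₁ x hx]
        exact mem_union_left _ (h₁.map_mem x hx)
      · rw [hf₂ x hx]
        exact mem_union_right _ (h₂.map_mem x hx)
    · rcases mem_union.1 hv with hv | hv
      · rw [hf₁ v (h₁.subset hv), h₁.map_eq v hv]
      · rw [hf₂ v (h₂.subset hv), h₂.map_eq v hv]
    · simp only [mem_union]
      rcases mem_union.1 hx with hx | hx <;> rcases mem_union.1 hy with hy | hy
      · rw [hf₁ x hx, hf₁ y hy]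
        exact (h₁.adj x hx y hy hxy).imp id fun h => ⟨.inl h.1, .inl h.2⟩
      · obtain ⟨h1, h2⟩ := hbridge x hx y hy hxy
        exact .inr ⟨.inl h1, .inr h2⟩
      · obtain ⟨h1, h2⟩ := hbridge y hy x hx hxy.symm
        exact .inr ⟨.inr h2, .inl h1⟩
      · rw [hf₂ x hx, hf₂ y hy]
        exact (h₂.adj x hx y hy hxy).imp id fun h => ⟨.inr h.1, .inr h.2⟩
    · rcases mem_union.1 hv with hv | hv
      · rw [hfib₁ v hv]
        exact h₁.isSquare v hv
      · rw [hfib₂ v hv]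
        exact h₂.isSquare v hv
    · rcases mem_union.1 hv with hv | hv
      · rw [hfib₁ v hv]
        exact h₁.numCross_eq v hv
      · rw [hfib₂ v hv]
        exact h₂.numCross_eq v hv
    · have := h₁.numEdges_quotient
      have := h₂.numEdges_quotient
      rw [numEdges_union hdQ, card_union_of_disjoint hdQ]
      omega
    · have := h₁.numEdges_eq
      have := h₂.numEdges_eq
      rw [numEdges_union hd, card_union_of_disjoint hdQ]
      omega

lemma ConnectedOn.connected_induce (hS : ConnectedOn G S) :
    ((⊤ : G.Subgraph).induce (S : Set V)).coe.Connected := by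
  obtain ⟨v, hv⟩ := hS.1
  have hvS : v ∈ ((⊤ : G.Subgraph).induce (S : Set V)).verts := hv
  classical
  obtain ⟨X, hX⟩ : ∃ X : Finset V, X = {u ∈ S |
    ∃ hu : u ∈ ((⊤ : G.Subgraph).induce (S : Set V)).verts,
      ((⊤ : G.Subgraph).induce (S : Set V)).coe.Reachable ⟨v, hvS⟩ ⟨u, hu⟩} := ⟨_, rfl⟩
  have hXS : X = S := by
    by_contra hne
    obtain ⟨a, ha, b, hb, hab⟩ := exists_adj_of_numCross_pos
      (hS.2 X (by rw [hX]; exact filter_subset _ _) ⟨v, by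
        rw [hX, mem_filter]
        exact ⟨hv, hvS, SimpleGraph.Reachable.refl _⟩⟩ hne)
    rw [hX, mem_filter] at ha
    obtain ⟨haS, ha', hr⟩ := ha
    rw [mem_sdiff] at hb
    refine hb.2 ?_
    rw [hX, mem_filter]
    refine ⟨hb.1, hb.1, hr.trans (SimpleGraph.Adj.reachable ?_)⟩
    exact ⟨haS, hb.1, hab⟩
  rw [SimpleGraph.connected_iff_exists_forall_reachable]
  refine ⟨⟨v, hvS⟩, fun ⟨u, hu⟩ => ?_⟩
  have hu' : u ∈ X := hXS ▸ (show u ∈ S from hu)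
  rw [hX, mem_filter] at hu'
  exact hu'.2.2

lemma ncard_edgeSet_induce (S : Finset V) :
    ((⊤ : G.Subgraph).induce (S : Set V)).edgeSet.ncard = numEdges G S := by
  rw [numEdges, ← Set.ncard_coe_finset]
  congr 1
  ext e
  induction e with | _ x y
  simp [and_assoc]

lemma ConnectedOn.isTree_induce (hS : ConnectedOn G S) (h : numEdges G S + 1 = #S) :
    ((⊤ : G.Subgraph).induce (S : Set V)).coe.IsTree := by
  have hfin : Finite ((⊤ : G.Subgraph).induce (S : Set V)).verts := S.finite_toSet.to_subtype
  rw [SimpleGraph.isTree_iff_connected_and_card]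
  refine ⟨hS.connected_induce, ?_⟩
  have h1 : Nat.card ((⊤ : G.Subgraph).induce (S : Set V)).coe.edgeSet = numEdges G S := by
    rw [← ncard_edgeSet_induce, ← SimpleGraph.Subgraph.image_coe_edgeSet_coe,
      Set.ncard_image_of_injective _ (Sym2.map.injective Subtype.val_injective)]
    rfl
  have h2 : Nat.card ((⊤ : G.Subgraph).induce (S : Set V)).verts = #S :=
    Set.ncard_coe_finset S
  rw [h1, h2, h]

lemma IsSquare.nonempty_iso_induce (h : IsSquare G S) :
    Nonempty (SimpleGraph.cycleGraph 4 ≃g ((⊤ : G.Subgraph).induce (S : Set V)).coe) := by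
  obtain ⟨c, hc, hS, ha⟩ := h.exists_fun
  refine ⟨⟨Equiv.ofBijective (fun i => ⟨c i, (hS _).2 ⟨i, rfl⟩⟩) ⟨fun i j hij => ?_, ?_⟩,
    fun {i j} => ?_⟩⟩
  · exact hc (congrArg Subtype.val hij)
  · rintro ⟨v, hv⟩
    obtain ⟨i, rfl⟩ := (hS v).1 hv
    exact ⟨i, rfl⟩
  · rw [← ha]
    simp only [SimpleGraph.Subgraph.coe_adj, SimpleGraph.Subgraph.induce_adj,
      SimpleGraph.Subgraph.top_adj]
    exact ⟨fun h => h.2.2, fun h => ⟨(hS _).2 ⟨i, rfl⟩, (hS _).2 ⟨j, rfl⟩, h⟩⟩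

lemma IsConstituentMap.isPureSpecial [Fintype V] {f : V → V} {m : ℕ}
    (h : IsConstituentMap G univ Q f) (hm : numEdges G univ = m) :
    IsPureSpecial m (SimpleGraph.cycleGraph 4) G := by
  have hQ : 0 < #Q := h.connectedOn.1.card_pos
  obtain ⟨v, hv⟩ : ∃ v : Fin #Q → V, v = fun i => (Q.equivFin.symm i : V) := ⟨_, rfl⟩
  have hvQ : ∀ i, v i ∈ Q := fun i => by simp [hv]
  have hvinj : Function.Injective v := by
    intro i j hij
    rw [hv] at hij
    exact Q.equivFin.symm.injective (Subtype.ext hij)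
  have hvsurj : ∀ x ∈ Q, ∃ i, v i = x := fun x hx => ⟨Q.equivFin ⟨x, hx⟩, by simp [hv]⟩
  obtain ⟨K, hK⟩ : ∃ K : Fin #Q → Finset V,
    K = fun i => ({x ∈ univ | f x = v i ∧ x ≠ v i} : Finset V) := ⟨_, rfl⟩
  have hmK : ∀ i x, x ∈ K i ↔ f x = v i ∧ x ≠ v i := by simp [hK]
  have hw : ∀ i, ∃ w ∈ K i, G.Adj (v i) w := by
    intro i
    have h1 : 0 < numCross G {v i} (K i) := by
      rw [hK, h.numCross_eq _ (hvQ i)]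
      omega
    obtain ⟨a, ha, w, hw, haw⟩ := exists_adj_of_numCross_pos h1
    exact ⟨w, hw, mem_singleton.1 ha ▸ haw⟩
  choose w hwK hvw using hw
  have hwuniq : ∀ i, ∀ x ∈ K i, G.Adj (v i) x → x = w i := by
    intro i x hx hvx
    refine (eq_of_numCross_le_one (A := {v i}) (B := K i) (G := G) ?_ (mem_singleton_self _) hx hvx
      (mem_singleton_self _) (hwK i) (hvw i)).2
    rw [hK, h.numCross_eq _ (hvQ i)]
  have hvK : ∀ i j, v i ∉ K j := by
    intro i j hij
    rw [hmK, h.map_eq _ (hvQ i)] at hij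
    exact hij.2 hij.1
  obtain ⟨F, hF⟩ : ∃ F : Fin #Q → G.Subgraph, F = fun i => (⊤ : G.Subgraph).induce (K i : Set V) :=
    ⟨_, rfl⟩
  have hFv : ∀ i, (F i).verts = (K i : Set V) := by simp [hF]
  have hFadj : ∀ i x y, (F i).Adj x y ↔ x ∈ K i ∧ y ∈ K i ∧ G.Adj x y := by simp [hF]
  -- The position of an arbitrary vertex with respect to the constituents.
  have hpos : ∀ x, x ∉ Q → ∃ i, f x = v i ∧ x ∈ K i := by
    intro x hx
    obtain ⟨i, hi⟩ := hvsurj _ (h.map_mem x (mem_univ x))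
    exact ⟨i, hi.symm, (hmK i x).2 ⟨hi.symm, fun hxi => hx (hxi ▸ hvQ i)⟩⟩
  refine ⟨{
    connected_F := SimpleGraph.cycleGraph_connected
    q := #Q
    r := 0
    division := by
      rw [ncard_edgeSet_cycleGraph_four, ← hm, h.numEdges_eq]
      ring
    r_le := Nat.zero_le _
    v := v
    v_injective := hvinj
    copyF := F
    isCopy := fun i => by
      have := (h.isSquare _ (hvQ i)).nonempty_iso_induce
      rw [hF, hK]
      exact this
    copyF_disjoint := fun i j hij => by
      rw [hFv, hFv, Set.disjoint_left]
      intro x hi hj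
      rw [mem_coe, hmK] at hi hj
      exact hij (hvinj (hi.1.symm.trans hj.1))
    v_notMem := fun i j => by
      rw [hFv]
      exact hvK i j
    w := w
    w_mem := fun i => by
      rw [hFv]
      exact hwK i
    adj_v_w := hvw
    constituent := fun i => F i ⊔ G.subgraphOfAdj (hvw i)
    constituent_eq := fun _ => rfl
    T := (⊤ : G.Subgraph).induce (Q : Set V)
    T_verts := by
      ext x
      simp only [SimpleGraph.Subgraph.induce_verts, mem_coe, Set.mem_range]
      exact ⟨hvsurj x, fun ⟨i, hi⟩ => hi ▸ hvQ i⟩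
    T_tree := fun _ => h.connectedOn.isTree_induce h.numEdges_quotient
    T' := G.singletonSubgraph (v ⟨#Q - 1, Nat.sub_lt hQ Nat.one_pos⟩)
    T'_connected := SimpleGraph.Subgraph.singletonSubgraph_connected.coe
    T'_edges_zero := fun h0 => by omega
    T'_edges_pos := fun _ => by simp
    T'_inter := fun _ => by
      refine (Set.inter_eq_left (s := {v ⟨#Q - 1, Nat.sub_lt hQ Nat.one_pos⟩})).2 ?_
      rintro x rfl
      exact Set.mem_iUnion.2 ⟨⟨#Q - 1, Nat.sub_lt hQ Nat.one_pos⟩, by simp⟩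
    cover := by
      refine le_antisymm (And.intro (fun x _ => ?_) fun x y hxy => ?_) le_top
      · simp only [SimpleGraph.Subgraph.verts_sup, SimpleGraph.Subgraph.verts_iSup, Set.mem_union,
          Set.mem_iUnion, hFv, SimpleGraph.Subgraph.induce_verts, mem_coe]
        by_cases hx : x ∈ Q
        · exact .inl (.inl hx)
        · obtain ⟨i, -, hi⟩ := hpos x hx
          exact .inr ⟨i, .inl hi⟩
      · have hxy : G.Adj x y := hxy
        simp only [SimpleGraph.Subgraph.sup_adj, SimpleGraph.Subgraph.iSup_adj, hFadj,
          SimpleGraph.Subgraph.induce_adj, mem_coe, SimpleGraph.Subgraph.top_adj,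
          SimpleGraph.subgraphOfAdj_adj, Sym2.eq_iff]
        by_cases hx : x ∈ Q <;> by_cases hy : y ∈ Q
        · exact .inl (.inl ⟨hx, hy, hxy⟩)
        · obtain ⟨i, hi, hyi⟩ := hpos y hy
          rcases h.adj x (mem_univ x) y (mem_univ y) hxy with h1 | h1
          · rw [h.map_eq x hx, hi] at h1
            subst h1
            exact .inr ⟨i, .inr (.inl ⟨rfl, (hwuniq i y hyi hxy).symm⟩)⟩
          · exact absurd h1.2 hy
        · obtain ⟨i, hi, hxi⟩ := hpos x hx
          rcases h.adj x (mem_univ x) y (mem_univ y) hxy with h1 | h1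
          · rw [h.map_eq y hy, hi] at h1
            subst h1
            exact .inr ⟨i, .inr (.inr ⟨rfl, (hwuniq i x hxi hxy.symm).symm⟩)⟩
          · exact absurd h1.1 hx
        · obtain ⟨i, hi, hxi⟩ := hpos x hx
          rcases h.adj x (mem_univ x) y (mem_univ y) hxy with h1 | h1
          · refine .inr ⟨i, .inl ⟨hxi, (hmK i y).2 ⟨h1 ▸ hi, ?_⟩, hxy⟩⟩
            exact fun hyi => hy (hyi ▸ hvQ i)
          · exact absurd h1.1 hx }, hQ, by simp⟩

end Isolation

open Isolation in
theorem mainTheorem1 {V : Type*} [Finite V] (G : SimpleGraph V) (hG : G.Connected)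
    (m : ℕ) (hm : G.edgeSet.ncard = m)
    (hC4 : ¬ Nonempty (SimpleGraph.cycleGraph 4 ≃g G)) :
    (Isolation.isolationNumber Isolation.nonTriangleCycles G : ℝ) ≤ ((m : ℝ) + 1) / 6 ∧
    ((Isolation.isolationNumber Isolation.nonTriangleCycles G : ℝ) = ((m : ℝ) + 1) / 6 ↔
      (Isolation.IsPureSpecial m (SimpleGraph.cycleGraph 4) G ∨
        Nonempty (Isolation.diamond ≃g G) ∨ Nonempty (SimpleGraph.cycleGraph 5 ≃g G))) ∧
    (Isolation.IsSpecial m (SimpleGraph.cycleGraph 4) G →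
      Isolation.isolationNumber Isolation.nonTriangleCycles G = ⌊((m : ℝ) + 1) / 6⌋₊) := by
  classical
  have := Fintype.ofFinite V
  have hm' : numEdges G Finset.univ = m := numEdges_univ.trans hm
  have hconn : ConnectedOn G (Finset.univ : Finset V) :=
    connectedOn_of_connected hG id (fun _ _ h => h) (by simp)
  have hsq : ¬ IsSquare G (Finset.univ : Finset V) := fun h => hC4 h.nonempty_iso
  have hmain := hasSlack_or_isExtremal hconn hsq
  have hbound : 6 * isolationNumber nonTriangleCycles G ≤ m + 1 := by
    obtain ⟨k, hk, hke⟩ := exists_canIsolate hmain hconn.1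
    have := isolationNumber_le hk
    omega
  have hcast : ((isolationNumber nonTriangleCycles G : ℝ) = ((m : ℝ) + 1) / 6) ↔
      6 * isolationNumber nonTriangleCycles G = m + 1 := by
    rw [eq_div_iff (by norm_num)]
    norm_cast
    rw [mul_comm]
  have hspecial : ∀ Z : SpecialStructure m (SimpleGraph.cycleGraph 4) G,
      isolationNumber nonTriangleCycles G = Z.q := fun Z => Z.isolationNumber_eq hm' hconn hsq
  -- A graph with five edges and a long cycle attains the bound.
  have hfive : G.edgeSet.ncard = 5 → HasLongCycle G Finset.univ →
      6 * isolationNumber nonTriangleCycles G = m + 1 := by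
    intro h5 hL
    have := isolationNumber_pos hL
    omega
  refine ⟨?_, ?_, ?_⟩
  · rw [le_div_iff₀ (by norm_num), mul_comm]
    exact_mod_cast hbound
  · rw [hcast]
    constructor
    · intro heq
      rcases hmain with ⟨k, hk, hke⟩ | h | ⟨Q, hQ⟩
      · have := isolationNumber_le hk
        omega
      · refine .inr (h.nonempty_iso hconn ?_)
        by_contra hL
        have := isolationNumber_le (canIsolate_of_not_hasLongCycle hL 0)
        omega
      · obtain ⟨f, hf⟩ := hQ.exists_map
        exact .inl (hf.isPureSpecial hm')
    · rintro (⟨Z, hq, hT⟩ | ⟨⟨f⟩⟩ | ⟨⟨f⟩⟩)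
      · have hdiv := Z.division
        have hr := Z.T'_edges_pos hq
        rw [hT, Set.ncard_empty] at hr
        rw [ncard_edgeSet_cycleGraph_four] at hdiv
        rw [hspecial Z]
        omega
      · exact hfive ((ncard_edgeSet_congr f).symm.trans ncard_edgeSet_diamond)
          (HasLongCycle.of_iso (n := 0) le_sup_left f)
      · exact hfive ((ncard_edgeSet_congr f).symm.trans ncard_edgeSet_cycleGraph_five)
          (HasLongCycle.of_iso (n := 1) le_rfl f)
  · rintro ⟨Z⟩
    have hdiv := Z.division
    have hr := Z.r_le
    rw [ncard_edgeSet_cycleGraph_four] at hdiv hr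
    have hfloor : ⌊((m : ℝ) + 1) / 6⌋₊ = (m + 1) / 6 := by
      have := Nat.floor_div_eq_div (K := ℝ) (m + 1) 6
      push_cast at this
      exact this
    rw [hspecial Z, hfloor]
    omega
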